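/- Let $G=(V,D,B)$ be a mixed graph: $V$ is a finite set, $D$ a set of directed edges $v\to w$ and $B$ a set of bidirected (unordered) edges $v\leftrightarrow w$, both without self-loops. Index matrices by $V\times V$. Let $\mathbb R^D_{\mathrm{reg}}$ be the set of real matrices $\Lambda$ with $\lambda_{vw}=0$ whenever $v\to w\notin D$ and with $I-\Lambda$ invertible, let $\mathrm{PD}(B)$ be the set of real symmetric positive definite matrices $\Omega$ with $\omega_{vw}=0$ whenever $v\neq w$ and $v\leftrightarrow w\notin B$, and put $\Theta=\mathbb R^D_{\mathrm{reg}}\times \mathrm{PD}(B)$ and $\phi_G(\Lambda,\Omega)=(I-\Lambda)^{-T}\Omega(I-\Lambda)^{-1}$. Let $\phi_{G,\mathbb C}$ be the map given by the same formula on the set $\Theta_{\mathbb C}$ of pairs $(\Lambda,\Omega)$ with $\Lambda\in\mathbb C^D_{\mathrm{reg}}$ (defined as above with complex entries) and $\Omega$ complex symmetric with $\omega_{vw}=0$ whenever $v\ne w$ and $v\leftrightarrow w\notin B$. A proper algebraic subset of $\Theta$ (or $\Theta_{\mathbb C}$) is a subset, different from the whole set, that is defined by polynomial equations in the entries of $(\Lambda,\Omega)$.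 The graph $G$ is *generically identifiable* if $\phi_G$ is injective on $\Theta\setminus W$ for some proper algebraic subset $W$; it is *rationally identifiable* if there are a proper algebraic subset $W$ and a rational map $\psi$ with $\psi(\phi_G(\Lambda,\Omega))=(\Lambda,\Omega)$ for all $(\Lambda,\Omega)\in\Theta\setminus W$. For $h\in\mathbb N\cup\{\infty\}$, the map $\phi_G$ (or $\phi_{G,\mathbb C}$) is *generically $h$-to-one* if, for some proper algebraic subset $W$ of its domain, the fiber through every point of the domain outside $W$ has exactly $h$ elements; $G$ is *generically infinite-to-one* if $\phi_G$ is generically $\infty$-to-one. The *degree of identifiability* $\mathrm{ID}(G)\in\mathbb N\cup\{\infty\}$ is the number $h$ for which $\phi_{G,\mathbb C}$ is generically $h$-to-one. Suppose that $G$ is acyclic, that is, $(V,D)$ has no directed cycle. Let $C_1,\dots,C_k\subset V$ be the vertex sets of the connected components of $(V,B)$, let $V_j$ be the union of $C_j$ and the set of all $p\in V$ with $p\to v\in D$ for some $v\in C_j$, let $D_j$ be the set of edges $v\to w$ in $D$ with $v\in V_j$ and $w\in C_j$, and let $B_j$ be the set of edges in $B$ between nodes of $C_j$. The graphs $G_j=(V_j,D_j,B_j)$,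 $j=1,\dots,k$, are the mixed components of $G$. Then: (i) $G$ is rationally identifiable if and only if all of $G_1,\dots,G_k$ are rationally identifiable, and $G$ is generically identifiable if and only if all of $G_1,\dots,G_k$ are generically identifiable. (ii) $G$ is generically infinite-to-one if and only if some $G_j$ is generically infinite-to-one; likewise, $\phi_{G,\mathbb C}$ is generically $\infty$-to-one if and only if some $\phi_{G_j,\mathbb C}$ is. (iii) If $h_1,\dots,h_k\in\mathbb N$ and each $\phi_{G_j}$ is generically $h_j$-to-one, then $\phi_G$ is generically $\left(\prod_{j=1}^k h_j\right)$-to-one; the same holds for $\phi_{G,\mathbb C}$ and the $\phi_{G_j,\mathbb C}$. Moreover, $\mathrm{ID}(G)=\prod_{j=1}^k\mathrm{ID}(G_j)$ in $\mathbb N\cup\{\infty\}$. -/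

import Mathlib

/-- A mixed graph `(V, D, B)`: directed edges `v → w` without self-loops, and symmetric
bidirected edges `v ↔ w` without self-loops (a simple graph). -/
structure MixedGraph (V : Type*) where
  directed : V → V → Prop
  directed_irrefl : ∀ v, ¬ directed v v
  bidirected : SimpleGraph V

/-- A pair `(Λ, Ω)` of square matrices. -/
abbrev ParamPair (V K : Type*) := Matrix V V K × Matrix V V K

/-- The entries of a pair `(Λ, Ω)`: `Sum.inl (v, w)` is `Λ v w`, `Sum.inr (v, w)` is `Ω v w`. -/
def ParamPair.coords {V K : Type*} (θ : ParamPair V K) : (V × V) ⊕ (V × V) → K :=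
  Sum.elim (fun e => θ.1 e.1 e.2) (fun e => θ.2 e.1 e.2)

/-- `W` is a proper algebraic subset of the parameter set `T`: it is the set of points of `T`
where some family of polynomials in the matrix entries vanishes, and it is not all of `T`. -/
def IsProperAlgebraicSubset {V K : Type*} [CommRing K] (T W : Set (ParamPair V K)) : Prop :=
  (∃ S : Set (MvPolynomial ((V × V) ⊕ (V × V)) K),
    W = {θ | θ ∈ T ∧ ∀ f ∈ S, MvPolynomial.eval θ.coords f = 0}) ∧ W ≠ T

/-- The parametrization `(Λ, Ω) ↦ (I - Λ)⁻ᵀ Ω (I - Λ)⁻¹`. -/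
noncomputable def covarianceMap {V K : Type*} [Fintype V] [DecidableEq V] [CommRing K]
    (θ : ParamPair V K) : Matrix V V K :=
  ((1 - θ.1)⁻¹).transpose * θ.2 * (1 - θ.1)⁻¹

/-- The fiber through `θ` of the parametrization restricted to the parameter set `T`. -/
def covarianceFiber {V K : Type*} [Fintype V] [DecidableEq V] [CommRing K]
    (T : Set (ParamPair V K)) (θ : ParamPair V K) : Set (ParamPair V K) :=
  {θ' | θ' ∈ T ∧ covarianceMap θ' = covarianceMap θ}

/-- The parametrization restricted to `T` is generically `h`-to-one, `h ∈ ℕ ∪ {∞}`: outside a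
proper algebraic subset of `T`, the fiber through every point has exactly `h` elements. -/
def IsGenericallyToOne {V K : Type*} [Fintype V] [DecidableEq V] [CommRing K]
    (T : Set (ParamPair V K)) (h : ℕ∞) : Prop :=
  ∃ W : Set (ParamPair V K), IsProperAlgebraicSubset T W ∧
    ∀ θ ∈ T \ W, (covarianceFiber T θ).encard = h

namespace MixedGraph

variable {V : Type*}

/-- The directed part has no directed cycles. -/
def Acyclic (G : MixedGraph V) : Prop :=
  ∀ v, ¬ Relation.TransGen G.directed v v

/-- `K^D_reg`: matrices `Λ` supported on the directed edges with `I - Λ` invertible. -/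
def regMatrices (K : Type*) [CommRing K] [Fintype V] [DecidableEq V] (G : MixedGraph V) :
    Set (Matrix V V K) :=
  {L | (∀ v w, ¬ G.directed v w → L v w = 0) ∧ IsUnit (1 - L)}

/-- `PD(B)`: real positive definite (symmetric) matrices whose off-diagonal entries are supported
on the bidirected edges. -/
def posDefMatrices (G : MixedGraph V) : Set (Matrix V V ℝ) :=
  {O | O.PosDef ∧ ∀ v w, v ≠ w → ¬ G.bidirected.Adj v w → O v w = 0}

/-- Complex symmetric matrices whose off-diagonal entries are supported on the bidirected edges. -/
def symMatrices (G : MixedGraph V) : Set (Matrix V V ℂ) :=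
  {O | O.IsSymm ∧ ∀ v w, v ≠ w → ¬ G.bidirected.Adj v w → O v w = 0}

section Identifiability

variable [Fintype V] [DecidableEq V]

/-- The real parameter space `Θ = ℝ^D_reg × PD(B)`. -/
def realParams (G : MixedGraph V) : Set (ParamPair V ℝ) :=
  G.regMatrices ℝ ×ˢ G.posDefMatrices

/-- The complex parameter space. -/
def complexParams (G : MixedGraph V) : Set (ParamPair V ℂ) :=
  G.regMatrices ℂ ×ˢ G.symMatrices

/-- `G` is generically identifiable: the parametrization is injective on the complement of a
proper algebraic subset of `Θ`. -/
def GenericallyIdentifiable (G : MixedGraph V) : Prop :=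
  ∃ W : Set (ParamPair V ℝ), IsProperAlgebraicSubset G.realParams W ∧
    Set.InjOn covarianceMap (G.realParams \ W)

/-- `G` is rationally identifiable: outside a proper algebraic subset of `Θ`, the parameters are
recovered from the covariance matrix by a rational map, with coordinates `num i / den i`, that is
defined there. -/
def RationallyIdentifiable (G : MixedGraph V) : Prop :=
  ∃ W : Set (ParamPair V ℝ), IsProperAlgebraicSubset G.realParams W ∧
    ∃ num den : (V × V) ⊕ (V × V) → MvPolynomial (V × V) ℝ,
      ∀ θ ∈ G.realParams \ W, ∀ i,
        MvPolynomial.eval (fun e => covarianceMap θ e.1 e.2) (den i) ≠ 0 ∧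
        MvPolynomial.eval (fun e => covarianceMap θ e.1 e.2) (num i) /
          MvPolynomial.eval (fun e => covarianceMap θ e.1 e.2) (den i) = θ.coords i

/-- `G` is generically infinite-to-one: the (real) fibers through all points outside a proper
algebraic subset of `Θ` are infinite. -/
def GenericallyInfiniteToOne (G : MixedGraph V) : Prop :=
  ∃ W : Set (ParamPair V ℝ), IsProperAlgebraicSubset G.realParams W ∧
    ∀ θ ∈ G.realParams \ W, (covarianceFiber G.realParams θ).Infinite

/-- The degree of identifiability `ID(G)`: the (unique) `h ∈ ℕ ∪ {∞}` such that the complex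
parametrization is generically `h`-to-one. -/
noncomputable def identifiabilityDegree (G : MixedGraph V) : ℕ∞ :=
  sInf {h : ℕ∞ | IsGenericallyToOne G.complexParams h}

end Identifiability

/-- The index set of the mixed components: the connected components of the bidirected part. -/
def ComponentIndex (G : MixedGraph V) : Type _ := G.bidirected.ConnectedComponent

/-- The vertex set `C_j` of a connected component of the bidirected part. -/
def componentCore (G : MixedGraph V) (j : G.ComponentIndex) : Set V :=
  {v | G.bidirected.connectedComponentMk v = j}

/-- `V_j`: the set `C_j` together with all parents of nodes in `C_j`. -/
def componentVertices (G : MixedGraph V) (j : G.ComponentIndex) : Set V :=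
  G.componentCore j ∪ {p | ∃ v ∈ G.componentCore j, G.directed p v}

/-- The mixed component `G_j = (V_j, D_j, B_j)`, where `D_j` consists of the directed edges
`v → w` of `G` with `v ∈ V_j` and `w ∈ C_j`, and `B_j` of the bidirected edges of `G` inside
`C_j`. -/
def mixedComponent (G : MixedGraph V) (j : G.ComponentIndex) :
    MixedGraph (G.componentVertices j) where
  directed v w := G.directed v w ∧ (w : V) ∈ G.componentCore j
  directed_irrefl v h := G.directed_irrefl v h.1
  bidirected :=
    { Adj := fun v w => G.bidirected.Adj v w ∧ (v : V) ∈ G.componentCore j ∧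
        (w : V) ∈ G.componentCore j
      symm := ⟨fun _ _ h => ⟨h.1.symm, h.2.2, h.2.1⟩⟩
      loopless := ⟨fun _ h => G.bidirected.irrefl h.1⟩ }

noncomputable instance [Finite V] (G : MixedGraph V) : Fintype G.ComponentIndex :=
  letI : Finite G.bidirected.ConnectedComponent := Quot.finite _
  Fintype.ofFinite G.bidirected.ConnectedComponent

noncomputable instance [Finite V] (G : MixedGraph V) (j : G.ComponentIndex) :
    Fintype (G.componentVertices j) :=
  Fintype.ofFinite _

end MixedGraph

/-! Order the vertices topologically. A symmetric matrix S with nonzero determinant and leading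
principal minors has a unique unit upper triangular R for which RᵀSR is an invertible diagonal
matrix (`IsLDL`, `IsLDL.unique`). If PᵀΩP = diag d is this decomposition of Ω, then R = (I - Λ)P,
with the same d, is that of Σ = φ_G(Λ, Ω). Uniqueness forces P to be block diagonal along the C_j
(`IsLDL.apply_eq_zero_of_block`). Hence the columns of R over C_j use only the columns of Λ over C_j
and the block of P over C_j, and they are supported on V_j: they are also the columns over C_j of
the factor for G_j.

So Σ and the covariance matrices Σ_j of the G_j determine each other by rational formulas
(`isLDL_restrictCols`, `isLDL_glueCols`), up to the variances of the parents in V_j \ C_j. These are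
parameters of G_j only, but such a parent is a source of D_j and isolated in B_j, so its variance is
an entry of Σ_j and constant on fibers. Therefore gluing parameters identifies the product of the
fibers of the φ_{G_j} with a fiber of φ_G (`bijOn_glue`), wherever the decompositions of the Ω_j
exist: everywhere in the real case by positive definiteness, generically in the complex case.

The rest is formal and is done once for both fields in `FiberSplitting`. Generic conditions on G
pass to G_j by freezing the other factors, those on the G_j pass to G along restriction with fixed
parent variances, and cardinalities of fibers multiply. Rational identifiability is not a statement
about fibers; it follows because the passage between Σ and the Σ_j stays inside algebras of
functions closed under inversion. -/

/-! ### Algebras of polynomial and rational functions on a set -/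

section FunctionAlgebras

variable {K : Type*} [Field K] {X Y ι : Type*}

/-- A subalgebra of functions is closed under inversion of nowhere vanishing functions. -/
def Subalgebra.InvClosed (B : Subalgebra K (X → K)) : Prop :=
  ∀ b ∈ B, (∀ x, b x ≠ 0) → (fun x => (b x)⁻¹) ∈ B

/-- The functions on `X` that are polynomial in the functions `s i`. -/
def polyAlgebra (s : ι → X → K) : Subalgebra K (X → K) :=
  Algebra.adjoin K (Set.range s)

theorem mem_polyAlgebra_self (s : ι → X → K) (i : ι) : s i ∈ polyAlgebra s :=
  Algebra.subset_adjoin ⟨i, rfl⟩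

theorem aeval_pi_apply (s : ι → X → K) (p : MvPolynomial ι K) (x : X) :
    MvPolynomial.aeval s p x = MvPolynomial.eval (fun i => s i x) p := by
  induction p using MvPolynomial.induction_on with
  | C a => simp
  | add p q hp hq => simp [hp, hq]
  | mul_X p i hp => simp [hp]

theorem mem_polyAlgebra_iff {s : ι → X → K} {f : X → K} :
    f ∈ polyAlgebra s ↔ ∃ p : MvPolynomial ι K, ∀ x, f x = MvPolynomial.eval (fun i => s i x) p := by
  rw [polyAlgebra, Algebra.adjoin_range_eq_range_aeval]
  constructor
  · rintro ⟨p, rfl⟩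
    exact ⟨p, fun x => aeval_pi_apply s p x⟩
  · rintro ⟨p, hp⟩
    exact ⟨p, funext fun x => (aeval_pi_apply s p x).trans (hp x).symm⟩

theorem const_mem (B : Subalgebra K (X → K)) (c : K) : (fun _ => c) ∈ B :=
  B.algebraMap_mem c

theorem comp_mem_of_mem_polyAlgebra {s : ι → X → K} {B : Subalgebra K (Y → K)} {t : Y → X}
    (h : ∀ i, (fun y => s i (t y)) ∈ B) {f : X → K} (hf : f ∈ polyAlgebra s) :
    (fun y => f (t y)) ∈ B := by
  induction hf using Algebra.adjoin_induction with
  | mem x hx => obtain ⟨i, rfl⟩ := hx; exact h i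
  | algebraMap c => exact const_mem B c
  | add f g _ _ hf hg => exact B.add_mem hf hg
  | mul f g _ _ hf hg => exact B.mul_mem hf hg

/-- The quotients of functions in `A` with nowhere vanishing denominator. -/
def fracAlgebra (A : Subalgebra K (X → K)) : Subalgebra K (X → K) where
  carrier := {g | ∃ n ∈ A, ∃ d ∈ A, ∀ x, d x ≠ 0 ∧ n x / d x = g x}
  mul_mem' := by
    rintro f g ⟨n, hn, d, hd, h⟩ ⟨n', hn', d', hd', h'⟩
    refine ⟨n * n', A.mul_mem hn hn', d * d', A.mul_mem hd hd', fun x => ⟨?_, ?_⟩⟩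
    · exact mul_ne_zero (h x).1 (h' x).1
    · simp only [Pi.mul_apply, ← (h x).2, ← (h' x).2]
      rw [div_mul_div_comm]
  add_mem' := by
    rintro f g ⟨n, hn, d, hd, h⟩ ⟨n', hn', d', hd', h'⟩
    refine ⟨n * d' + d * n', A.add_mem (A.mul_mem hn hd') (A.mul_mem hd hn'), d * d',
      A.mul_mem hd hd', fun x => ⟨?_, ?_⟩⟩
    · exact mul_ne_zero (h x).1 (h' x).1
    · simp only [Pi.mul_apply, Pi.add_apply, ← (h x).2, ← (h' x).2]
      rw [div_add_div _ _ (h x).1 (h' x).1]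
  algebraMap_mem' c := ⟨fun _ => c, const_mem A c, 1, A.one_mem, fun x => by simp⟩

theorem le_fracAlgebra (A : Subalgebra K (X → K)) : A ≤ fracAlgebra A :=
  fun f hf => ⟨f, hf, 1, A.one_mem, fun x => by simp⟩

theorem invClosed_fracAlgebra (A : Subalgebra K (X → K)) : (fracAlgebra A).InvClosed := by
  rintro f ⟨n, hn, d, hd, h⟩ h0
  refine ⟨d, hd, n, hn, fun x => ⟨fun hx => h0 x ?_, ?_⟩⟩
  · rw [← (h x).2, hx, zero_div]
  · simp only [← (h x).2, inv_div]

/-- Substitution into a rational function: this transports a rational inverse of one parametrization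
to another. -/
theorem comp_mem_of_mem_fracAlgebra {s : ι → X → K} {B : Subalgebra K (Y → K)}
    (hB : B.InvClosed) {t : Y → X} (h : ∀ i, (fun y => s i (t y)) ∈ B) {f : X → K}
    (hf : f ∈ fracAlgebra (polyAlgebra s)) : (fun y => f (t y)) ∈ B := by
  obtain ⟨n, hn, d, hd, hnd⟩ := hf
  have := B.mul_mem (comp_mem_of_mem_polyAlgebra h hn)
    (hB _ (comp_mem_of_mem_polyAlgebra h hd) fun y => (hnd (t y)).1)
  convert this using 1
  funext y
  rw [← (hnd (t y)).2, Pi.mul_apply, div_eq_mul_inv]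

section Matrices

variable {m n l : Type*} [Fintype n] {B : Subalgebra K (X → K)}

theorem sum_fun_mem {κ : Type*} (s : Finset κ) {f : κ → X → K} (h : ∀ k ∈ s, f k ∈ B) :
    (fun x => ∑ k ∈ s, f k x) ∈ B := by
  have := B.sum_mem h
  convert this using 1
  funext x
  simp

theorem prod_fun_mem {κ : Type*} (s : Finset κ) {f : κ → X → K} (h : ∀ k ∈ s, f k ∈ B) :
    (fun x => ∏ k ∈ s, f k x) ∈ B := by
  have := B.prod_mem h
  convert this using 1
  funext x
  simp

theorem ite_fun_mem {p : Prop} [Decidable p] {f g : X → K} (hf : p → f ∈ B) (hg : ¬ p → g ∈ B) :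
    (fun x => if p then f x else g x) ∈ B := by
  by_cases h : p
  · simpa [h] using hf h
  · simpa [h] using hg h

theorem matrix_mul_mem {M : X → Matrix m n K} {N : X → Matrix n l K}
    (hM : ∀ i j, (fun x => M x i j) ∈ B) (hN : ∀ i j, (fun x => N x i j) ∈ B) (i : m) (j : l) :
    (fun x => (M x * N x) i j) ∈ B := by
  simp only [Matrix.mul_apply]
  exact sum_fun_mem _ fun k _ => B.mul_mem (hM i k) (hN k j)

theorem matrix_det_mem [DecidableEq n] {M : X → Matrix n n K}
    (hM : ∀ i j, (fun x => M x i j) ∈ B) : (fun x => (M x).det) ∈ B := by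
  simp only [Matrix.det_apply']
  exact sum_fun_mem _ fun σ _ => B.mul_mem (const_mem B _) (prod_fun_mem _ fun k _ => hM _ _)

/-- Cramer's rule: only the determinant has to be inverted. -/
theorem matrix_inv_mem [DecidableEq n] (hB : B.InvClosed) {M : X → Matrix n n K}
    (hM : ∀ i j, (fun x => M x i j) ∈ B) (h0 : ∀ x, (M x).det ≠ 0) (i j : n) :
    (fun x => (M x)⁻¹ i j) ∈ B := by
  simp only [Matrix.inv_def, Ring.inverse_eq_inv', Matrix.smul_apply, smul_eq_mul,
    Matrix.adjugate_apply]
  refine B.mul_mem (hB _ (matrix_det_mem hM) h0) (matrix_det_mem fun k l => ?_)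
  simp only [Matrix.updateRow_apply]
  exact ite_fun_mem (fun _ => const_mem B _) fun _ => hM k l

end Matrices

end FunctionAlgebras

open Matrix

/-! ### Triangular decomposition of symmetric matrices -/

section LDL

set_option linter.unusedSectionVars false

variable {V K : Type*} [Fintype V] [DecidableEq V] [Field K] {r : V → ℕ}

/-- Unit upper triangular matrices for the order on `V` given by `r`. -/
structure IsUnitUpper (r : V → ℕ) (R : Matrix V V K) : Prop where
  tri : R.BlockTriangular r
  diag : ∀ v, R v v = 1

/-- `Rᵀ S R = diag d` with `R` unit upper triangular and `d` nowhere zero. -/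
structure IsLDL (r : V → ℕ) (S R : Matrix V V K) (d : V → K) : Prop extends IsUnitUpper r R where
  eq : Rᵀ * S * R = diagonal d
  ne : ∀ v, d v ≠ 0

theorem mul_diag_of_blockTriangular (hr : r.Injective) {M N : Matrix V V K}
    (hM : M.BlockTriangular r) (hN : N.BlockTriangular r) (v : V) :
    (M * N) v v = M v v * N v v := by
  rw [mul_apply, Finset.sum_eq_single v]
  · intro w _ hw
    rcases lt_or_gt_of_ne (hr.ne hw) with h | h
    · rw [hM h, zero_mul]
    · rw [hN h, mul_zero]
  · simp

namespace IsUnitUpper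

theorem det_eq_one (hr : r.Injective) {R : Matrix V V K} (hR : IsUnitUpper r R) : R.det = 1 := by
  let : LinearOrder V := LinearOrder.lift' r hr
  have h : R.IsUpperTriangular := fun i j hij => hR.tri hij
  rw [det_of_isUpperTriangular h]
  exact Finset.prod_eq_one fun v _ => hR.diag v

theorem isUnit_det (hr : r.Injective) {R : Matrix V V K} (hR : IsUnitUpper r R) :
    IsUnit R.det := by
  rw [hR.det_eq_one hr]
  exact isUnit_one

theorem isUnit (hr : r.Injective) {R : Matrix V V K} (hR : IsUnitUpper r R) : IsUnit R :=
  (isUnit_iff_isUnit_det R).2 (hR.isUnit_det hr)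

theorem mul (hr : r.Injective) {M N : Matrix V V K} (hM : IsUnitUpper r M)
    (hN : IsUnitUpper r N) : IsUnitUpper r (M * N) :=
  ⟨hM.tri.mul hN.tri, fun v => by
    rw [mul_diag_of_blockTriangular hr hM.tri hN.tri, hM.diag, hN.diag, one_mul]⟩

theorem inv (hr : r.Injective) {M : Matrix V V K} (hM : IsUnitUpper r M) :
    IsUnitUpper r M⁻¹ := by
  have hu := hM.isUnit_det hr
  let := invertibleOfIsUnitDet M hu
  have ht : M⁻¹.BlockTriangular r := blockTriangular_inv_of_blockTriangular hM.tri
  refine ⟨ht, fun v => ?_⟩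
  have h := mul_diag_of_blockTriangular hr ht hM.tri v
  rw [nonsing_inv_mul _ hu, hM.diag, mul_one, one_apply_eq] at h
  exact h.symm

theorem one_sub {L : Matrix V V K} (hL : ∀ u v, r v ≤ r u → L u v = 0) :
    IsUnitUpper r (1 - L) where
  tri u v h := by
    have huv : u ≠ v := by rintro rfl; exact lt_irrefl _ h
    simp [hL u v h.le, huv]
  diag v := by simp [hL v v le_rfl]

end IsUnitUpper

namespace IsLDL

variable {S S' R R' : Matrix V V K} {d d' : V → K}

theorem eq_inv (hr : r.Injective) (h : IsLDL r S R d) : S = R⁻¹ᵀ * diagonal d * R⁻¹ := by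
  have hu := h.isUnit_det hr
  have hu' : IsUnit Rᵀ.det := by rwa [det_transpose]
  rw [← h.eq, transpose_nonsing_inv, Matrix.mul_assoc Rᵀ, nonsing_inv_mul_cancel_left _ _ hu',
    mul_nonsing_inv_cancel_right _ _ hu]

theorem eq_of_eq (hr : r.Injective) (h : IsLDL r S R d) (h' : IsLDL r S' R d) : S = S' :=
  (h.eq_inv hr).trans (h'.eq_inv hr).symm

/-- For M = R⁻¹R' one gets diag(d) M = M⁻ᵀ diag(d'), where the left side is upper and the right side
lower triangular. As d vanishes nowhere, M is diagonal, hence the identity. -/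
theorem unique (hr : r.Injective) (h : IsLDL r S R d) (h' : IsLDL r S R' d') :
    R = R' ∧ d = d' := by
  have hu := h.isUnit_det hr
  set M := R⁻¹ * R' with hM
  have hMu : IsUnitUpper r M := (h.toIsUnitUpper.inv hr).mul hr h'.toIsUnitUpper
  have hR' : R' = R * M := by rw [hM, mul_nonsing_inv_cancel_left _ _ hu]
  clear_value M
  have e1 : Mᵀ * (diagonal d * M) = diagonal d' := by
    rw [← h.eq, ← h'.eq, hR', transpose_mul]
    simp only [Matrix.mul_assoc]
  have hdu : IsUnit Mᵀ.det := by rw [det_transpose]; exact hMu.isUnit_det hr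
  have e2 : diagonal d * M = M⁻¹ᵀ * diagonal d' := by
    rw [← e1, transpose_nonsing_inv, nonsing_inv_mul_cancel_left _ _ hdu]
  have hM1 : M = 1 := by
    ext u v
    by_cases huv : u = v
    · subst huv; rw [hMu.diag, one_apply_eq]
    rw [one_apply_ne huv]
    rcases lt_or_gt_of_ne (fun hh => huv (hr hh)) with hlt | hlt
    · have e3 := congrFun (congrFun e2 u) v
      rw [diagonal_mul, mul_diagonal, transpose_apply, (hMu.inv hr).tri hlt, zero_mul] at e3
      exact (mul_eq_zero.1 e3).resolve_left (h.ne u)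
    · exact hMu.tri hlt
  rw [hM1] at hR' e1
  refine ⟨by rw [hR', Matrix.mul_one], ?_⟩
  rw [transpose_one, Matrix.mul_one, Matrix.one_mul] at e1
  exact diagonal_injective e1

/-- Let t be 1 on the block of u and -1 elsewhere. Conjugation by diag(t) fixes S, hence fixes R by
uniqueness, while it changes the sign of the entry at (u, v). -/
theorem apply_eq_zero_of_block [CharZero K] (hr : r.Injective) (h : IsLDL r S R d) {α : Type*}
    (c : V → α) (hS : ∀ u v, c u ≠ c v → S u v = 0) (u v : V) (huv : c u ≠ c v) : R u v = 0 := by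
  classical
  set t : V → K := fun w => if c w = c u then 1 else -1 with ht
  have ht2 : ∀ w, t w * t w = 1 := fun w => by
    simp only [ht]; split_ifs <;> simp
  have htt : diagonal t * diagonal t = (1 : Matrix V V K) := by
    rw [diagonal_mul_diagonal, ← diagonal_one]
    exact congrArg _ (funext ht2)
  have hSt : diagonal t * S * diagonal t = S := by
    ext a b
    rw [mul_diagonal, diagonal_mul]
    by_cases hab : c a = c b
    · have : t a = t b := by simp only [ht, hab]
      rw [this, mul_right_comm, ht2, one_mul]
    · rw [hS a b hab]; simp
  have h' : IsLDL r S (diagonal t * R * diagonal t) d :=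
    { tri := fun a b hab => by rw [mul_diagonal, diagonal_mul, h.tri hab]; simp
      diag := fun a => by rw [mul_diagonal, diagonal_mul, h.diag, mul_one, ht2]
      eq := by
        have e : diagonal t * (Rᵀ * (diagonal t * S * diagonal t) * R) * diagonal t
            = diagonal d := by
          rw [hSt, h.eq, diagonal_mul_diagonal, diagonal_mul_diagonal]
          congr 1
          funext w
          rw [mul_right_comm, ht2, one_mul]
        rw [transpose_mul, transpose_mul, diagonal_transpose, ← e]
        simp only [Matrix.mul_assoc]
      ne := h.ne }
  have e := congrFun (congrFun (h.unique hr h').1 u) v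
  rw [mul_diagonal, diagonal_mul] at e
  have hu : t u = 1 := by simp [ht]
  have hv : t v = -1 := by simp [ht, Ne.symm huv]
  rw [hu, hv] at e
  have : (2 : K) * R u v = 0 := by linear_combination e
  simpa using this

end IsLDL

/-- The unit upper triangular factor of the `LDL` decomposition, by Cramer's rule. -/
noncomputable def ldlFactor (r : V → ℕ) (S : Matrix V V K) : Matrix V V K :=
  fun u v => if u = v then 1 else if h : r u < r v then
    -(((S.submatrix (Subtype.val : {w // r w < r v} → V) Subtype.val)⁻¹ *ᵥ
      fun w : {w // r w < r v} => S w v) ⟨u, h⟩) else 0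

/-- The product of the determinant and of all leading principal minors. -/
noncomputable def minorProd (r : V → ℕ) (S : Matrix V V K) : K :=
  S.det * ∏ v, (S.submatrix (Subtype.val : {w // r w < r v} → V) Subtype.val).det

theorem isUnitUpper_ldlFactor (S : Matrix V V K) : IsUnitUpper r (ldlFactor r S) where
  tri u v h := by
    have huv : u ≠ v := by rintro rfl; exact lt_irrefl _ h
    simp only [ldlFactor, if_neg huv, dif_neg (not_lt.2 (le_of_lt h))]
  diag v := by simp [ldlFactor]

/-- Column v of the factor is chosen to solve exactly these linear equations; the sum splits into
the vertices before v and v itself. -/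
theorem mul_ldlFactor_apply {S : Matrix V V K} {u v : V} (huv : r u < r v)
    (h : (S.submatrix (Subtype.val : {w // r w < r v} → V) Subtype.val).det ≠ 0) :
    (S * ldlFactor r S) u v = 0 := by
  rw [mul_apply, ← Fintype.sum_subtype_add_sum_subtype (fun w => r w < r v)]
  have e1 : ∑ w : {w // ¬ r w < r v}, S u w * ldlFactor r S w v = S u v := by
    rw [Fintype.sum_eq_single ⟨v, lt_irrefl _⟩]
    · simp [ldlFactor]
    · rintro ⟨w, hw⟩ hwv
      have hne : w ≠ v := fun hh => hwv (Subtype.ext hh)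
      simp [ldlFactor, hw, hne]
  have e2 : ∑ w : {w // r w < r v}, S u w * ldlFactor r S w v =
      -(((S.submatrix (Subtype.val : {w // r w < r v} → V) Subtype.val) *ᵥ
        ((S.submatrix (Subtype.val : {w // r w < r v} → V) Subtype.val)⁻¹ *ᵥ
      fun w : {w // r w < r v} => S w v)) ⟨u, huv⟩) := by
    conv_rhs => rw [mulVec, dotProduct, ← Finset.sum_neg_distrib]
    refine Finset.sum_congr rfl fun w _ => ?_
    have hne : (w : V) ≠ v := by rintro hh; exact lt_irrefl _ (hh ▸ w.2)
    simp only [ldlFactor, if_neg hne, dif_pos w.2, submatrix_apply, mul_neg]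
  rw [e1, e2, mulVec_mulVec, mul_nonsing_inv _ (isUnit_iff_ne_zero.2 h), one_mulVec,
    neg_add_cancel]

/-- SR vanishes above the diagonal and Rᵀ is lower triangular, so RᵀSR vanishes above the diagonal,
and by symmetry below it. -/
theorem isLDL_ldlFactor (hr : r.Injective) {S : Matrix V V K} (hS : S.IsSymm)
    (h : minorProd r S ≠ 0) :
    IsLDL r S (ldlFactor r S) (fun v => ((ldlFactor r S)ᵀ * S * ldlFactor r S) v v) := by
  obtain ⟨hdet, hm⟩ := mul_ne_zero_iff.1 h
  rw [Finset.prod_ne_zero_iff] at hm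
  set R := ldlFactor r S with hR
  have hRu : IsUnitUpper r R := isUnitUpper_ldlFactor S
  have hsymm : (Rᵀ * S * R)ᵀ = Rᵀ * S * R := by
    simp only [transpose_mul, transpose_transpose, hS.eq, Matrix.mul_assoc]
  have hlow : ∀ u v, r u < r v → (Rᵀ * S * R) u v = 0 := by
    intro u v huv
    rw [Matrix.mul_assoc, mul_apply]
    refine Finset.sum_eq_zero fun w _ => ?_
    by_cases hw : r w < r v
    · rw [hR, mul_ldlFactor_apply hw (hm v (Finset.mem_univ v)), mul_zero]
    · rw [transpose_apply, hRu.tri (huv.trans_le (not_lt.1 hw)), zero_mul]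
  have heq : Rᵀ * S * R = diagonal (fun v => (Rᵀ * S * R) v v) := by
    ext u v
    by_cases huv : u = v
    · subst huv; rw [diagonal_apply_eq]
    rw [diagonal_apply_ne _ huv]
    rcases lt_or_gt_of_ne (fun hh => huv (hr hh)) with hlt | hlt
    · exact hlow u v hlt
    · rw [← hsymm, transpose_apply]; exact hlow v u hlt
  -- Since det R = 1, the product of the diagonal entries is det S; this is why `minorProd` includes
  -- the full determinant.
  refine ⟨hRu, heq, fun v hv => hdet ?_⟩
  have := congrArg det heq
  rw [det_mul, det_mul, det_transpose, hRu.det_eq_one hr, one_mul, mul_one, det_diagonal] at this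
  exact this.trans (Finset.prod_eq_zero (Finset.mem_univ v) hv)

theorem Matrix.PosDef.minorProd_pos {S : Matrix V V ℝ} (hS : S.PosDef) : 0 < minorProd r S :=
  mul_pos hS.det_pos (Finset.prod_pos fun _ _ => (hS.submatrix Subtype.val_injective).det_pos)

theorem minorProd_mem {X : Type*} {B : Subalgebra K (X → K)} {S : X → Matrix V V K}
    (hS : ∀ i j, (fun x => S x i j) ∈ B) : (fun x => minorProd r (S x)) ∈ B :=
  B.mul_mem (matrix_det_mem hS) (prod_fun_mem _ fun _ _ => matrix_det_mem fun _ _ => hS _ _)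

theorem ldlFactor_mem {X : Type*} {B : Subalgebra K (X → K)} (hB : B.InvClosed)
    {S : X → Matrix V V K} (hS : ∀ i j, (fun x => S x i j) ∈ B)
    (h : ∀ x, minorProd r (S x) ≠ 0) (i j : V) : (fun x => ldlFactor r (S x) i j) ∈ B := by
  have hm : ∀ x v, ((S x).submatrix (Subtype.val : {w // r w < r v} → V) Subtype.val).det ≠ 0 :=
    fun x v => Finset.prod_ne_zero_iff.1 (mul_ne_zero_iff.1 (h x)).2 v (Finset.mem_univ v)
  unfold ldlFactor
  by_cases hij : i = j
  · simp only [if_pos hij]; exact const_mem B 1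
  simp only [if_neg hij]
  by_cases hlt : r i < r j
  · simp only [dif_pos hlt, mulVec, dotProduct]
    refine B.neg_mem (sum_fun_mem _ fun w _ => B.mul_mem ?_ (hS _ _))
    exact matrix_inv_mem hB (fun a b => hS _ _) (fun x => hm x j) _ _
  · simp only [dif_neg hlt]; exact const_mem B 0

section Covariance

variable {L O R P : Matrix V V K} {d : V → K}

/-- The factor I - Λ cancels its inverse in Σ, and it is itself unit upper triangular for a
topological order. -/
theorem IsLDL.covarianceMap (hr : r.Injective) (hL : ∀ u v, r v ≤ r u → L u v = 0)
    (h : IsLDL r O P d) : IsLDL r (covarianceMap (L, O)) ((1 - L) * P) d where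
  toIsUnitUpper := (IsUnitUpper.one_sub hL).mul hr h.toIsUnitUpper
  eq := by
    have hu := (IsUnitUpper.one_sub hL).isUnit_det hr
    have hu' : IsUnit (1 - L)ᵀ.det := by rwa [det_transpose]
    rw [← h.eq, _root_.covarianceMap, transpose_mul, transpose_nonsing_inv]
    simp only [Matrix.mul_assoc]
    rw [nonsing_inv_mul_cancel_left _ _ hu, mul_nonsing_inv_cancel_left _ _ hu']
  ne := h.ne

theorem IsLDL.of_covarianceMap (hr : r.Injective) (hL : ∀ u v, r v ≤ r u → L u v = 0)
    (h : IsLDL r (_root_.covarianceMap (L, O)) R d) : IsLDL r O ((1 - L)⁻¹ * R) d where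
  toIsUnitUpper := ((IsUnitUpper.one_sub hL).inv hr).mul hr h.toIsUnitUpper
  eq := by
    rw [← h.eq, _root_.covarianceMap, transpose_mul]
    simp only [Matrix.mul_assoc]
  ne := h.ne

end Covariance

end LDL

/-! ### Formal consequences of a product decomposition of fibers -/

section Splitting

set_option linter.unusedSectionVars false

variable {K : Type*} [Field K] {ι : Type*} [Fintype ι] [DecidableEq ι] {X : Type*}
  {Y : ι → Type*}

/-- A set `T` with fibers `F` is split by the map `glue` into the sets `T' i` with fibers `F' i`,
outside the zero loci of the functions `e i`; `A` and `A' i` are the algebras of polynomial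
functions. -/
structure FiberSplitting (A : Subalgebra K (X → K)) (A' : ∀ i, Subalgebra K (Y i → K))
    (T : Set X) (T' : ∀ i, Set (Y i)) (F : X → Set X) (F' : ∀ i, Y i → Set (Y i))
    (glue : (∀ i, Y i) → X) (e : ∀ i, Y i → K) : Prop where
  glue_mem : ∀ η, (∀ i, η i ∈ T' i) → glue η ∈ T
  comp_update : ∀ f ∈ A, ∀ η i, (fun y => f (glue (Function.update η i y))) ∈ A' i
  e_mem : ∀ i, e i ∈ A' i
  exists_ne : ∀ i, ∀ f ∈ A' i, (∃ y ∈ T' i, f y ≠ 0) → ∃ y ∈ T' i, f y ≠ 0 ∧ e i y ≠ 0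
  nonempty : ∀ i, (T' i).Nonempty
  -- The restriction depends on a base point because gluing forgets part of the data (the parent
  -- variances): η₀ supplies the forgotten values. The last clause says that these values are
  -- constant along fibers.
  exists_res : ∀ η₀, (∀ i, η₀ i ∈ T' i) → ∃ ρ : ∀ i, X → Y i,
    (∀ i, ∀ f ∈ A' i, (fun x => f (ρ i x)) ∈ A) ∧ (∀ i, ρ i (glue η₀) = η₀ i) ∧
    (∀ x ∈ T, (∀ i, ρ i x ∈ T' i) ∧ glue (fun i => ρ i x) = x) ∧
    ∀ x ∈ T, ∀ η, (∀ i, η i ∈ F' i (ρ i x)) → ∀ i, ρ i (glue η) = η i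
  bijOn : ∀ η, (∀ i, η i ∈ T' i) → (∀ i, e i (η i) ≠ 0) →
    Set.BijOn glue (Set.pi Set.univ fun i => F' i (η i)) (F (glue η))
  fiber_subset : ∀ i y, F' i y ⊆ T' i
  mem_fiber : ∀ i, ∀ y ∈ T' i, y ∈ F' i y

/-- Outside the zero locus of a polynomial function that is not identically zero on `T`, the
property `Q` holds. -/
def HoldsGenerically (A : Subalgebra K (X → K)) (T : Set X) (Q : X → Prop) : Prop :=
  ∃ f ∈ A, (∃ x ∈ T, f x ≠ 0) ∧ ∀ x ∈ T, f x ≠ 0 → Q x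

/-- The fibers separate the points outside the zero locus of a polynomial function. -/
def SeparatesGenerically (A : Subalgebra K (X → K)) (T : Set X) (F : X → Set X) : Prop :=
  ∃ f ∈ A, (∃ x ∈ T, f x ≠ 0) ∧ ∀ x ∈ T, f x ≠ 0 → ∀ x' ∈ T, f x' ≠ 0 → x' ∈ F x → x' = x

namespace FiberSplitting

variable {A : Subalgebra K (X → K)} {A' : ∀ i, Subalgebra K (Y i → K)}
    {T : Set X} {T' : ∀ i, Set (Y i)} {F : X → Set X} {F' : ∀ i, Y i → Set (Y i)}
    {glue : (∀ i, Y i) → X} {e : ∀ i, Y i → K}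

theorem encard_fiber (H : FiberSplitting A A' T T' F F' glue e) {η : ∀ i, Y i}
    (hη : ∀ i, η i ∈ T' i) (he : ∀ i, e i (η i) ≠ 0) :
    (F (glue η)).encard = ∏ i, (F' i (η i)).encard := by
  rw [← Set.encard_pi_eq_prod_encard, ← (H.bijOn η hη he).image_eq,
    (H.bijOn η hη he).injOn.encard_image]

/-- Starting from the restrictions of a point where f is nonzero, the coordinates are moved into the
sets Q i one at a time. With the others frozen, f is a polynomial function of one coordinate that is
not identically zero on its set. -/
theorem exists_glue_ne (H : FiberSplitting A A' T T' F F' glue e) (Q : ∀ i, Set (Y i))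
    (hQ : ∀ i, ∀ f ∈ A' i, (∃ y ∈ T' i, f y ≠ 0) → ∃ y ∈ T' i, f y ≠ 0 ∧ y ∈ Q i)
    {f : X → K} (hf : f ∈ A) (hT : ∃ x ∈ T, f x ≠ 0) :
    ∃ η : ∀ i, Y i, (∀ i, η i ∈ T' i ∧ η i ∈ Q i) ∧ f (glue η) ≠ 0 := by
  obtain ⟨x, hx, hfx⟩ := hT
  choose η₀ hη₀ using H.nonempty
  obtain ⟨ρ, -, -, hρ, -⟩ := H.exists_res η₀ hη₀
  suffices h : ∀ s : Finset ι, ∃ η : ∀ i, Y i, (∀ i, η i ∈ T' i) ∧ (∀ i ∈ s, η i ∈ Q i) ∧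
      f (glue η) ≠ 0 by
    obtain ⟨η, h1, h2, h3⟩ := h Finset.univ
    exact ⟨η, fun i => ⟨h1 i, h2 i (Finset.mem_univ i)⟩, h3⟩
  intro s
  induction s using Finset.induction_on with
  | empty => exact ⟨fun i => ρ i x, (hρ x hx).1, by simp, by rwa [(hρ x hx).2]⟩
  | insert i s _ ih =>
    obtain ⟨η, h1, h2, h3⟩ := ih
    obtain ⟨y, hy, hfy, hyQ⟩ := hQ i _ (H.comp_update f hf η i)
      ⟨η i, h1 i, by rwa [Function.update_eq_self]⟩
    refine ⟨Function.update η i y, fun k => ?_, fun k hk => ?_, hfy⟩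
    · by_cases hki : k = i
      · subst hki; simpa using hy
      · simpa [hki] using h1 k
    · by_cases hki : k = i
      · subst hki; simpa using hyQ
      · simpa [hki] using h2 k ((Finset.mem_insert.1 hk).resolve_left hki)

theorem update_mem {T' : ∀ i, Set (Y i)} {η : ∀ i, Y i} (hη : ∀ i, η i ∈ T' i) {i : ι} {y : Y i}
    (hy : y ∈ T' i) (k : ι) : Function.update η i y k ∈ T' k := by
  by_cases hki : k = i
  · subst hki; simpa using hy
  · simpa [hki] using hη k

theorem update_ne {e : ∀ i, Y i → K} {η : ∀ i, Y i} (hη : ∀ i, e i (η i) ≠ 0) {i : ι} {y : Y i}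
    (hy : e i y ≠ 0) (k : ι) : e k (Function.update η i y k) ≠ 0 := by
  by_cases hki : k = i
  · subst hki; simpa using hy
  · simpa [hki] using hη k

/-- Polynomial conditions on the factors can be imposed simultaneously. -/
theorem exists_common (H : FiberSplitting A A' T T' F F' glue e) (f : ∀ i, Y i → K)
    (hf : ∀ i, f i ∈ A' i) (hT : ∀ i, ∃ y ∈ T' i, f i y ≠ 0) :
    ∃ g ∈ A, (∃ x ∈ T, g x ≠ 0) ∧ ∃ ρ : ∀ i, X → Y i,
      (∀ i, ∀ f ∈ A' i, (fun x => f (ρ i x)) ∈ A) ∧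
      (∀ x ∈ T, (∀ i, ρ i x ∈ T' i) ∧ glue (fun i => ρ i x) = x) ∧
      (∀ x ∈ T, ∀ η, (∀ i, η i ∈ F' i (ρ i x)) → ∀ i, ρ i (glue η) = η i) ∧
      ∀ x, g x ≠ 0 → ∀ i, f i (ρ i x) ≠ 0 ∧ e i (ρ i x) ≠ 0 := by
  -- These points serve twice: they are the base point of the restriction, and their gluing
  -- witnesses that the product of the pulled back functions is not identically zero.
  choose η₀ hη₀ hfη₀ heη₀ using fun i => H.exists_ne i (f i) (hf i) (hT i)
  obtain ⟨ρ, h1, h2, h3, h4⟩ := H.exists_res η₀ hη₀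
  refine ⟨fun x => ∏ i, f i (ρ i x) * e i (ρ i x),
    prod_fun_mem _ fun i _ => A.mul_mem (h1 i _ (hf i)) (h1 i _ (H.e_mem i)),
    ⟨glue η₀, H.glue_mem η₀ hη₀, ?_⟩, ρ, h1, h3, h4, fun x hx i => ?_⟩
  · refine Finset.prod_ne_zero_iff.2 fun i _ => ?_
    rw [h2]
    exact mul_ne_zero (hfη₀ i) (heη₀ i)
  · exact mul_ne_zero_iff.1 (Finset.prod_ne_zero_iff.1 hx i (Finset.mem_univ i))

theorem prod_of_generically (H : FiberSplitting A A' T T' F F' glue e) {h : ι → ℕ∞}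
    (hh : ∀ i, HoldsGenerically (A' i) (T' i) fun y => (F' i y).encard = h i) :
    HoldsGenerically A T fun x => (F x).encard = ∏ i, h i := by
  choose f hf hT hQ using hh
  obtain ⟨g, hg, hgT, ρ, -, h3, -, h5⟩ := H.exists_common f hf hT
  refine ⟨g, hg, hgT, fun x hx hgx => ?_⟩
  obtain ⟨hm, hgl⟩ := h3 x hx
  conv_lhs => rw [← hgl]
  rw [H.encard_fiber hm fun i => (h5 x hgx i).2]
  exact Finset.prod_congr rfl fun i _ => hQ i _ (hm i) (h5 x hgx i).1

theorem encard_fiber_ne_zero (H : FiberSplitting A A' T T' F F' glue e) {i : ι} {y : Y i}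
    (hy : y ∈ T' i) : (F' i y).encard ≠ 0 :=
  Set.encard_ne_zero.2 ⟨y, H.mem_fiber i y hy⟩

/-- A product of nonempty fibers is infinite exactly if a factor is. If no factor is generically
infinite, the points with finite fiber meet every nonvanishing locus, so `exists_glue_ne` yields a
finite fiber of T where all should be infinite. -/
theorem infinite_iff (H : FiberSplitting A A' T T' F F' glue e) :
    (HoldsGenerically A T fun x => (F x).encard = ⊤) ↔
      ∃ i, HoldsGenerically (A' i) (T' i) fun y => (F' i y).encard = ⊤ := by
  constructor
  · rintro ⟨f, hf, hT, hQ⟩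
    by_contra! hcon
    obtain ⟨η, hη, hfη⟩ := H.exists_glue_ne (fun i => {y | e i y ≠ 0 ∧ (F' i y).encard ≠ ⊤})
      (fun i p hp hpT => by
        obtain ⟨y₀, hy₀, hpy₀, hey₀⟩ := H.exists_ne i p hp hpT
        by_contra! hc
        refine hcon i ⟨p * e i, (A' i).mul_mem hp (H.e_mem i),
          ⟨y₀, hy₀, mul_ne_zero hpy₀ hey₀⟩, fun y hy hy0 => ?_⟩
        obtain ⟨a, b⟩ := mul_ne_zero_iff.1 hy0
        by_contra hne
        exact hc y hy a ⟨b, hne⟩) hf hT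
    have h1 : (F (glue η)).encard = ⊤ := hQ _ (H.glue_mem η fun i => (hη i).1) hfη
    rw [H.encard_fiber (fun i => (hη i).1) fun i => (hη i).2.1] at h1
    obtain ⟨i, -, hi⟩ := WithTop.prod_eq_top_ex_top h1
    exact (hη i).2.2 hi
  · rintro ⟨j, f, hf, hT, hQ⟩
    choose η₀ hη₀ using H.nonempty
    obtain ⟨g, hg, hgT, ρ, -, h3, -, h5⟩ := H.exists_common
      -- Only factor j carries a condition.
      (Function.update (fun _ => 1) j f)
      (fun i => by
        by_cases hij : i = j
        · subst hij; simpa using hf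
        · simp [hij])
      (fun i => by
        by_cases hij : i = j
        · subst hij; simpa using hT
        · exact ⟨η₀ i, hη₀ i, by simp [hij]⟩)
    refine ⟨g, hg, hgT, fun x hx hgx => ?_⟩
    obtain ⟨hm, hgl⟩ := h3 x hx
    conv_lhs => rw [← hgl]
    rw [H.encard_fiber hm fun i => (h5 x hgx i).2]
    refine WithTop.prod_eq_top (Finset.mem_univ j) (hQ _ (hm j) ?_)
      fun i _ => H.encard_fiber_ne_zero (hm i)
    simpa using (h5 x hgx j).1

/-- Forward, freeze the other factors at a generic point: two points in one fiber of factor i glue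
to two points in one fiber of T. Backward, a point of the fiber through x is glued from points in
the fibers through the restrictions of x, and these points are its own restrictions, hence also
generic. -/
theorem separates_iff (H : FiberSplitting A A' T T' F F' glue e) :
    SeparatesGenerically A T F ↔ ∀ i, SeparatesGenerically (A' i) (T' i) (F' i) := by
  constructor
  · rintro ⟨f, hf, hT, hQ⟩ i
    obtain ⟨η, hη, hfη⟩ := H.exists_glue_ne (fun i => {y | e i y ≠ 0}) H.exists_ne hf hT
    have hηT := fun i => (hη i).1
    have hηe : ∀ i, e i (η i) ≠ 0 := fun i => (hη i).2
    refine ⟨fun y => f (glue (Function.update η i y)) * e i y,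
      (A' i).mul_mem (H.comp_update f hf η i) (H.e_mem i),
      ⟨η i, hηT i, by simpa using ⟨hfη, hηe i⟩⟩, fun y hy hy0 y' hy' hy0' hF => ?_⟩
    obtain ⟨a, b⟩ := mul_ne_zero_iff.1 hy0
    obtain ⟨a', b'⟩ := mul_ne_zero_iff.1 hy0'
    have hb := H.bijOn (Function.update η i y) (update_mem hηT hy) (update_ne hηe b)
    have hmem : ∀ z ∈ F' i y, Function.update η i z ∈
        Set.pi Set.univ fun k => F' k (Function.update η i y k) := by
      intro z hz k _
      by_cases hki : k = i
      · subst hki; simpa using hz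
      · simpa [hki] using H.mem_fiber k _ (hηT k)
    have := hQ _ (H.glue_mem _ (update_mem hηT hy)) a _ (H.glue_mem _ (update_mem hηT hy')) a'
      (hb.mapsTo (hmem y' hF))
    have := hb.injOn (hmem y' hF) (hmem y (H.mem_fiber i y hy)) this
    simpa using congrFun this i
  · intro hh
    choose f hf hT hQ using hh
    obtain ⟨g, hg, hgT, ρ, -, h3, h4, h5⟩ := H.exists_common f hf hT
    refine ⟨g, hg, hgT, fun x hx hgx x' hx' hgx' hF => ?_⟩
    obtain ⟨hm, hgl⟩ := h3 x hx
    have hb := H.bijOn _ hm fun i => (h5 x hgx i).2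
    rw [hgl] at hb
    obtain ⟨η, hη, rfl⟩ := hb.surjOn hF
    have hη' : ∀ i, η i ∈ F' i (ρ i x) := fun i => hη i (Set.mem_univ i)
    have hρ := h4 x hx η hη'
    conv_rhs => rw [← hgl]
    congr 1
    funext i
    refine hQ i _ (hm i) (h5 x hgx i).1 _ (H.fiber_subset i _ (hη' i)) ?_ (hη' i)
    rw [← hρ i]
    exact (h5 _ hgx' i).1

/-- If the fibers of `T` have generically `h < ∞` elements, then so do the fibers of the factors,
for numbers with product `h`. -/
theorem exists_generically_of_prod (H : FiberSplitting A A' T T' F F' glue e) {h : ℕ∞}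
    (hh : h ≠ ⊤) (hG : HoldsGenerically A T fun x => (F x).encard = h) :
    ∃ h' : ι → ℕ∞, ∏ i, h' i = h ∧
      ∀ i, HoldsGenerically (A' i) (T' i) fun y => (F' i y).encard = h' i := by
  obtain ⟨f, hf, hT, hQ⟩ := hG
  obtain ⟨η, hη, hfη⟩ := H.exists_glue_ne (fun i => {y | e i y ≠ 0}) H.exists_ne hf hT
  have hηT := fun i => (hη i).1
  have hηe : ∀ i, e i (η i) ≠ 0 := fun i => (hη i).2
  -- The numbers are read off at one generic point. Moving coordinate i keeps the product equal to h
  -- and the other factors fixed, so the i-th cardinality is constant.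
  have hprod : ∏ i, (F' i (η i)).encard = h := by
    rw [← H.encard_fiber hηT hηe]
    exact hQ _ (H.glue_mem η hηT) hfη
  refine ⟨fun i => (F' i (η i)).encard, hprod, fun i => ?_⟩
  refine ⟨fun y => f (glue (Function.update η i y)) * e i y,
      (A' i).mul_mem (H.comp_update f hf η i) (H.e_mem i),
      ⟨η i, hηT i, by simpa using ⟨hfη, hηe i⟩⟩, fun y hy hy0 => ?_⟩
  obtain ⟨a, b⟩ := mul_ne_zero_iff.1 hy0
  have h1 : (F (glue (Function.update η i y))).encard = h :=
    hQ _ (H.glue_mem _ (update_mem hηT hy)) a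
  rw [H.encard_fiber (update_mem hηT hy) (update_ne hηe b),
    ← Finset.mul_prod_erase _ _ (Finset.mem_univ i)] at h1
  have h2 := hprod
  rw [← Finset.mul_prod_erase _ _ (Finset.mem_univ i)] at h2
  have h3 : ∏ k ∈ Finset.univ.erase i, (F' k (Function.update η i y k)).encard =
      ∏ k ∈ Finset.univ.erase i, (F' k (η k)).encard :=
    Finset.prod_congr rfl fun k hk => by rw [Function.update_of_ne (Finset.ne_of_mem_erase hk)]
  rw [h3, Function.update_self] at h1
  set c := ∏ k ∈ Finset.univ.erase i, (F' k (η k)).encard with hc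
  -- Cancelling c in ℕ∞ requires it to be nonzero and finite; finiteness comes from h ≠ ⊤.
  have hc0 : c ≠ 0 := Finset.prod_ne_zero_iff.2 fun k _ => H.encard_fiber_ne_zero (hηT k)
  have hct : c ≠ ⊤ := by
    rintro hct
    rw [hct, ENat.mul_top (H.encard_fiber_ne_zero (hηT i))] at h2
    exact hh h2.symm
  exact (ENat.mul_left_strictMono hc0 hct).injective (h1.trans h2.symm)

end FiberSplitting

end Splitting

/-! ### Gluing and restricting matrices along the mixed components -/

namespace MixedGraph

section Gluing

variable {V K : Type*} [Fintype V] [DecidableEq V] [Field K] (G : MixedGraph V)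

set_option linter.unusedSectionVars false

/-- The component of the bidirected part that contains `v`. -/
def component (v : V) : G.ComponentIndex := G.bidirected.connectedComponentMk v

theorem mem_componentVertices_self (v : V) : v ∈ G.componentVertices (G.component v) :=
  Or.inl rfl

theorem component_eq_of_adj {u v : V} (h : G.bidirected.Adj u v) :
    G.component u = G.component v :=
  SimpleGraph.ConnectedComponent.connectedComponentMk_eq_of_adj h

open Classical in
/-- Extension of a matrix indexed by `V_j` by zero. -/
noncomputable def extendZero (j : G.ComponentIndex)
    (M : Matrix (G.componentVertices j) (G.componentVertices j) K) : Matrix V V K :=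
  fun u v => if h : u ∈ G.componentVertices j ∧ v ∈ G.componentVertices j then
    M ⟨u, h.1⟩ ⟨v, h.2⟩ else 0

/-- The matrix whose columns over `C_j` are those of `M j`. -/
noncomputable def glueCols
    (M : ∀ j, Matrix (G.componentVertices j) (G.componentVertices j) K) : Matrix V V K :=
  fun u v => G.extendZero (G.component v) (M (G.component v)) u v

open Classical in
/-- The block diagonal matrix whose block over `C_j` is that of `M j`. -/
noncomputable def glueBlocks
    (M : ∀ j, Matrix (G.componentVertices j) (G.componentVertices j) K) : Matrix V V K :=
  fun u v => if G.component u = G.component v then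
    G.extendZero (G.component v) (M (G.component v)) u v else 0

/-- The vector that agrees with `d j` on `C_j`. -/
def glueVec (d : ∀ j, G.componentVertices j → K) : V → K :=
  fun v => d (G.component v) ⟨v, G.mem_componentVertices_self v⟩

/-- The parameters of `G` assembled from parameters of the mixed components. -/
noncomputable def glue (η : ∀ j, ParamPair (G.componentVertices j) K) : ParamPair V K :=
  (G.glueCols fun j => (η j).1, G.glueBlocks fun j => (η j).2)

open Classical in
/-- Restriction to `V_j`, with the columns outside `C_j` replaced by those of `diag w`. -/
noncomputable def restrictCols (j : G.ComponentIndex) (w : G.componentVertices j → K)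
    (M : Matrix V V K) : Matrix (G.componentVertices j) (G.componentVertices j) K :=
  fun u v => if (v : V) ∈ G.componentCore j then M u v else if u = v then w u else 0

open Classical in
/-- Restriction to `V_j`, with the entries outside `C_j` replaced by those of `w`. -/
noncomputable def restrictVec (j : G.ComponentIndex) (w : G.componentVertices j → K)
    (d : V → K) : G.componentVertices j → K :=
  fun v => if (v : V) ∈ G.componentCore j then d v else w v

/-- The parameters of `G_j` obtained from those of `G`, with variances `w` of the parents. -/
noncomputable def restrictParams (j : G.ComponentIndex) (w : G.componentVertices j → K)
    (θ : ParamPair V K) : ParamPair (G.componentVertices j) K :=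
  (G.restrictCols j 0 θ.1, G.restrictCols j w θ.2)

theorem glue_fst (η : ∀ j, ParamPair (G.componentVertices j) K) :
    (G.glue η).1 = G.glueCols fun j => (η j).1 := rfl

theorem glue_snd (η : ∀ j, ParamPair (G.componentVertices j) K) :
    (G.glue η).2 = G.glueBlocks fun j => (η j).2 := rfl

/-- Block diagonal matrices with respect to the components. -/
def IsBlock (M : Matrix V V K) : Prop := ∀ u v, G.component u ≠ G.component v → M u v = 0

variable {G}

theorem IsBlock.mul {M N : Matrix V V K} (hM : G.IsBlock M) (hN : G.IsBlock N) :
    G.IsBlock (M * N) := fun u v h => by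
  rw [mul_apply]
  refine Finset.sum_eq_zero fun x _ => ?_
  by_cases hx : G.component u = G.component x
  · rw [hN x v (hx ▸ h), mul_zero]
  · rw [hM u x hx, zero_mul]

theorem IsBlock.transpose {M : Matrix V V K} (hM : G.IsBlock M) : G.IsBlock Mᵀ :=
  fun u v h => hM v u h.symm

theorem isBlock_glueBlocks
    (M : ∀ j, Matrix (G.componentVertices j) (G.componentVertices j) K) :
    G.IsBlock (G.glueBlocks M) := fun u v h => by simp [glueBlocks, h]

theorem IsBlock.ext {M N : Matrix V V K} (hM : G.IsBlock M) (hN : G.IsBlock N)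
    (h : ∀ u v, G.component u = G.component v → M u v = N u v) : M = N := by
  ext u v
  by_cases huv : G.component u = G.component v
  · exact h u v huv
  · rw [hM u v huv, hN u v huv]

section Restrict

variable {j : G.ComponentIndex} {w w' : G.componentVertices j → K}

theorem restrictCols_apply_of_mem {M : Matrix V V K} (u v : G.componentVertices j)
    (hv : (v : V) ∈ G.componentCore j) : G.restrictCols j w M u v = M u v := by
  simp only [restrictCols, if_pos hv]

theorem restrictCols_apply_of_notMem {M : Matrix V V K} (u v : G.componentVertices j)
    (hv : (v : V) ∉ G.componentCore j) :
    G.restrictCols j w M u v = if u = v then w u else 0 := by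
  simp only [restrictCols, if_neg hv]

/-- A column of N over C_j is supported on C_j, so the product sees only the columns of M over C_j
and no index outside V_j. The replaced columns are diagonal and multiply entrywise. -/
theorem restrictCols_mul {M N : Matrix V V K} (hN : G.IsBlock N) :
    G.restrictCols j (w * w') (M * N) = G.restrictCols j w M * G.restrictCols j w' N := by
  ext u v
  by_cases hv : (v : V) ∈ G.componentCore j
  · have h0 : ∀ x : V, x ∉ G.componentCore j → N x v = 0 := fun x hx =>
      hN x v fun hh => hx (hh.trans hv)
    rw [restrictCols_apply_of_mem _ _ hv, mul_apply, mul_apply]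
    refine (Fintype.sum_of_injective _ Subtype.val_injective _ _ (fun x hx => ?_)
      fun x => ?_).symm
    · rw [h0 x fun hh => hx ⟨⟨x, Or.inl hh⟩, rfl⟩, mul_zero]
    · rw [restrictCols_apply_of_mem _ _ hv]
      by_cases hx : (x : V) ∈ G.componentCore j
      · rw [restrictCols_apply_of_mem _ _ hx]
      · rw [h0 x hx, mul_zero, mul_zero]
  · rw [restrictCols_apply_of_notMem _ _ hv, mul_apply, Fintype.sum_eq_single v]
    · rw [restrictCols_apply_of_notMem _ _ hv, restrictCols_apply_of_notMem _ _ hv]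
      by_cases huv : u = v
      · subst huv; simp
      · simp [huv]
    · intro x hx
      rw [restrictCols_apply_of_notMem x v hv, if_neg hx, mul_zero]

theorem restrictCols_diagonal (d : V → K) :
    G.restrictCols j w (diagonal d) = diagonal (G.restrictVec j w d) := by
  ext u v
  by_cases huv : u = v
  · subst huv; simp [restrictCols, restrictVec]
  · have : (u : V) ≠ v := fun h => huv (Subtype.ext h)
    simp [restrictCols, huv, this]

theorem restrictCols_transpose {M : Matrix V V K} (hM : G.IsBlock M) :
    G.restrictCols j w Mᵀ = (G.restrictCols j w M)ᵀ := by
  ext u v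
  rw [transpose_apply]
  by_cases hv : (v : V) ∈ G.componentCore j
  · rw [restrictCols_apply_of_mem _ _ hv, transpose_apply]
    by_cases hu : (u : V) ∈ G.componentCore j
    · rw [restrictCols_apply_of_mem _ _ hu]
    · have huv : v ≠ u := fun h => hu (h ▸ hv)
      rw [restrictCols_apply_of_notMem _ _ hu, if_neg huv]
      exact hM _ _ fun hh => hu (hh.symm.trans hv)
  · rw [restrictCols_apply_of_notMem _ _ hv]
    by_cases hu : (u : V) ∈ G.componentCore j
    · have huv : u ≠ v := fun h => hv (h ▸ hu)
      rw [restrictCols_apply_of_mem _ _ hu, if_neg huv]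
      exact (hM _ _ fun hh => hv (hh.trans hu)).symm
    · rw [restrictCols_apply_of_notMem _ _ hu]
      by_cases huv : u = v
      · subst huv; rfl
      · rw [if_neg huv, if_neg (Ne.symm huv)]

theorem restrictCols_one_sub (L : Matrix V V K) :
    G.restrictCols j 1 (1 - L) = 1 - G.restrictCols j 0 L := by
  ext u v
  by_cases hv : (v : V) ∈ G.componentCore j
  · simp [restrictCols, hv, Matrix.one_apply, Subtype.ext_iff]
  · simp [restrictCols, hv, Matrix.one_apply]

end Restrict

theorem extendZero_apply {j : G.ComponentIndex}
    (M : Matrix (G.componentVertices j) (G.componentVertices j) K)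
    (u v : G.componentVertices j) : G.extendZero j M u v = M u v := by
  simp [extendZero]

theorem glueCols_apply {j : G.ComponentIndex}
    (M : ∀ j, Matrix (G.componentVertices j) (G.componentVertices j) K)
    (u v : G.componentVertices j) (hv : (v : V) ∈ G.componentCore j) :
    G.glueCols M u v = M j u v := by
  obtain ⟨v, hv'⟩ := v
  obtain rfl : G.component v = j := hv
  exact extendZero_apply _ u ⟨v, hv'⟩

theorem glueBlocks_apply {j : G.ComponentIndex}
    (M : ∀ j, Matrix (G.componentVertices j) (G.componentVertices j) K)
    (u v : G.componentVertices j) (hu : (u : V) ∈ G.componentCore j)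
    (hv : (v : V) ∈ G.componentCore j) : G.glueBlocks M u v = M j u v := by
  have : G.glueBlocks M u v = G.glueCols M u v := if_pos (Eq.trans hu (Eq.symm hv))
  rw [this, glueCols_apply M u v hv]

theorem glueCols_eq_zero
    (M : ∀ j, Matrix (G.componentVertices j) (G.componentVertices j) K) {u v : V}
    (h : u ∉ G.componentVertices (G.component v)) : G.glueCols M u v = 0 :=
  dif_neg fun hh => h hh.1

theorem restrictCols_glueCols {j : G.ComponentIndex} {w : G.componentVertices j → K}
    (M : ∀ j, Matrix (G.componentVertices j) (G.componentVertices j) K)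
    (h : ∀ u v : G.componentVertices j, (v : V) ∉ G.componentCore j →
      M j u v = if u = v then w u else 0) :
    G.restrictCols j w (G.glueCols M) = M j := by
  ext u v
  by_cases hv : (v : V) ∈ G.componentCore j
  · rw [restrictCols_apply_of_mem _ _ hv, glueCols_apply M u v hv]
  · rw [restrictCols_apply_of_notMem _ _ hv, h u v hv]

theorem restrictCols_glueBlocks {j : G.ComponentIndex} {w : G.componentVertices j → K}
    (M : ∀ j, Matrix (G.componentVertices j) (G.componentVertices j) K)
    (h : ∀ u v : G.componentVertices j, u ≠ v →
      ¬ ((u : V) ∈ G.componentCore j ∧ (v : V) ∈ G.componentCore j) → M j u v = 0) (hw : ∀ u : G.componentVertices j, (u : V) ∉ G.componentCore j → M j u u = w u) :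
    G.restrictCols j w (G.glueBlocks M) = M j := by
  ext u v
  by_cases hv : (v : V) ∈ G.componentCore j
  · rw [restrictCols_apply_of_mem _ _ hv]
    by_cases hu : (u : V) ∈ G.componentCore j
    · rw [glueBlocks_apply M u v hu hv]
    · have huv : u ≠ v := fun hh => hu (hh ▸ hv)
      rw [h u v huv fun hh => hu hh.1]
      exact isBlock_glueBlocks M _ _ fun hh => hu (hh.trans hv)
  · rw [restrictCols_apply_of_notMem _ _ hv]
    by_cases huv : u = v
    · subst huv; rw [if_pos rfl, hw u hv]
    · rw [if_neg huv, h u v huv fun hh => hv hh.2]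

end Gluing

/-! ### Parameters and covariance matrices of a graph and its mixed components -/

section Parameters

variable {V : Type*} [Fintype V] [DecidableEq V]

/-- Pairs `(Λ, Ω)` with `Ω` symmetric and both supported on the edges. -/
def symParams (G : MixedGraph V) (K : Type*) [Field K] : Set (ParamPair V K) :=
  {θ | (∀ v w, ¬ G.directed v w → θ.1 v w = 0) ∧ θ.2.IsSymm ∧
    ∀ v w, v ≠ w → ¬ G.bidirected.Adj v w → θ.2 v w = 0}

variable {K : Type*} [Field K] {G : MixedGraph V}

theorem isBlock_of_mem_symParams {θ : ParamPair V K} (hθ : θ ∈ G.symParams K) :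
    G.IsBlock θ.2 := fun u v h =>
  hθ.2.2 u v (fun e => h (e ▸ rfl)) fun hadj => h (G.component_eq_of_adj hadj)

theorem apply_eq_zero_of_mem_symParams {j : G.ComponentIndex}
    {η : ParamPair (G.componentVertices j) K} (hη : η ∈ (G.mixedComponent j).symParams K)
    (u v : G.componentVertices j) (huv : u ≠ v)
    (h : ¬ ((u : V) ∈ G.componentCore j ∧ (v : V) ∈ G.componentCore j)) : η.2 u v = 0 :=
  hη.2.2 u v huv fun hadj => h hadj.2

/-- Any w works since gluing reads only columns over the C_j. Nothing of Λ is lost because V_j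
contains all parents of C_j. -/
theorem glue_restrictParams {θ : ParamPair V K} (hθ : θ ∈ G.symParams K)
    (w : ∀ j, G.componentVertices j → K) :
    G.glue (fun j => G.restrictParams j (w j) θ) = θ := by
  refine Prod.ext ?_ ?_
  · rw [glue_fst]
    ext u v
    by_cases hu : u ∈ G.componentVertices (G.component v)
    · exact (glueCols_apply _ ⟨u, hu⟩ ⟨v, G.mem_componentVertices_self v⟩ rfl).trans
        (restrictCols_apply_of_mem (j := G.component v) _ _ (Eq.refl (G.component v)))
    · refine (glueCols_eq_zero _ hu).trans (hθ.1 u v fun hd => hu (Or.inr ⟨v, rfl, hd⟩)).symm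
  · rw [glue_snd]
    refine (isBlock_glueBlocks _).ext (isBlock_of_mem_symParams hθ) fun u v huv => ?_
    exact (glueBlocks_apply _ ⟨u, Or.inl huv⟩ ⟨v, G.mem_componentVertices_self v⟩ huv rfl).trans
        (restrictCols_apply_of_mem (j := G.component v) _ _ (Eq.refl (G.component v)))

/-- The parent variances are lost in gluing, so w has to supply them. -/
theorem restrictParams_glue {η : ∀ j, ParamPair (G.componentVertices j) K}
    (j : G.ComponentIndex) {w : G.componentVertices j → K}
    (hη : η j ∈ (G.mixedComponent j).symParams K)
    (hw : ∀ u : G.componentVertices j, (u : V) ∉ G.componentCore j → (η j).2 u u = w u) :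
    G.restrictParams j w (G.glue η) = η j := by
  refine Prod.ext ?_ ?_
  · refine restrictCols_glueCols (fun j => (η j).1) fun u v hv => ?_
    rw [hη.1 u v fun hd => hv hd.2]
    simp
  · exact restrictCols_glueBlocks (fun j => (η j).2) (apply_eq_zero_of_mem_symParams hη) hw

theorem glue_mem_symParams {η : ∀ j, ParamPair (G.componentVertices j) K}
    (hη : ∀ j, η j ∈ (G.mixedComponent j).symParams K) : G.glue η ∈ G.symParams K := by
  refine ⟨fun u v huv => ?_, ?_, fun u v huv hadj => ?_⟩
  · rw [glue_fst]
    by_cases hu : u ∈ G.componentVertices (G.component v)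
    · refine (glueCols_apply (fun j => (η j).1) ⟨u, hu⟩
        ⟨v, G.mem_componentVertices_self v⟩ rfl).trans ?_
      exact (hη _).1 _ _ fun hd => huv hd.1
    · exact glueCols_eq_zero _ hu
  · rw [glue_snd]
    refine (isBlock_glueBlocks _).transpose.ext (isBlock_glueBlocks _) fun u v huv => ?_
    refine (glueBlocks_apply (fun j => (η j).2) ⟨v, G.mem_componentVertices_self v⟩
      ⟨u, Or.inl huv⟩ rfl huv).trans
      (Eq.trans ?_
        (glueBlocks_apply (fun j => (η j).2) ⟨u, Or.inl huv⟩
          ⟨v, G.mem_componentVertices_self v⟩ huv rfl).symm)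
    exact (hη _).2.1.apply _ _
  · rw [glue_snd]
    by_cases hc : G.component u = G.component v
    · refine (glueBlocks_apply (fun j => (η j).2) ⟨u, Or.inl hc⟩
        ⟨v, G.mem_componentVertices_self v⟩ hc
        rfl).trans ?_
      exact (hη _).2.2 _ _ (fun h => huv (congrArg Subtype.val h)) fun h => hadj h.1
    · exact isBlock_glueBlocks _ u v hc

theorem restrictParams_mem_symParams {θ : ParamPair V K} (hθ : θ ∈ G.symParams K)
    (j : G.ComponentIndex) (w : G.componentVertices j → K) :
    G.restrictParams j w θ ∈ (G.mixedComponent j).symParams K := by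
  refine ⟨fun u v huv => ?_, ?_, fun u v huv hadj => ?_⟩
  · by_cases hv : (v : V) ∈ G.componentCore j
    · exact (restrictCols_apply_of_mem _ _ hv).trans (hθ.1 _ _ fun hd => huv ⟨hd, hv⟩)
    · refine (restrictCols_apply_of_notMem _ _ hv).trans ?_
      simp
  · have := restrictCols_transpose (j := j) (w := w) (isBlock_of_mem_symParams hθ)
    rw [hθ.2.1.eq] at this
    exact this.symm
  · by_cases hv : (v : V) ∈ G.componentCore j
    · refine (restrictCols_apply_of_mem _ _ hv).trans ?_
      by_cases hu : (u : V) ∈ G.componentCore j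
      · exact hθ.2.2 _ _ (fun h => huv (Subtype.ext h)) fun h => hadj ⟨h, hu, hv⟩
      · exact isBlock_of_mem_symParams hθ _ _ fun hh => hu (hh.trans hv)
    · exact (restrictCols_apply_of_notMem _ _ hv).trans (if_neg huv)

section Covariance

variable {r : V → ℕ}

theorem apply_eq_zero_of_le {W : Type*} {r : W → ℕ} [Fintype W] [DecidableEq W]
    {H : MixedGraph W} {θ : ParamPair W K} (hθ : θ ∈ H.symParams K)
    (hd : ∀ u v, H.directed u v → r u < r v) (u v : W) (h : r v ≤ r u) : θ.1 u v = 0 :=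
  hθ.1 u v fun hh => absurd (hd u v hh) (not_lt.2 h)

/-- Passage from Σ to Σ_j. Since Ω and its factor P are block diagonal, restriction is compatible
with the products in PᵀΩP and (I - Λ)P, and the parents become trivial blocks with variances w. -/
theorem isLDL_restrictCols [CharZero K] (hr : r.Injective)
    (hd : ∀ u v, G.directed u v → r u < r v)
    {θ : ParamPair V K} (hθ : θ ∈ G.symParams K) {R : Matrix V V K} {d : V → K}
    (h : IsLDL r (covarianceMap θ) R d) (j : G.ComponentIndex) {w : G.componentVertices j → K}
    (hw : ∀ u : G.componentVertices j, (u : V) ∉ G.componentCore j → w u ≠ 0) :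
    IsLDL (fun u : G.componentVertices j => r u) (covarianceMap (G.restrictParams j w θ))
      (G.restrictCols j 1 R) (G.restrictVec j w d) := by
  have hL := apply_eq_zero_of_le hθ hd
  have hP : IsLDL r θ.2 ((1 - θ.1)⁻¹ * R) d := IsLDL.of_covarianceMap hr hL h
  set P := (1 - θ.1)⁻¹ * R with hPdef
  have hR : R = (1 - θ.1) * P := by
    rw [hPdef, mul_nonsing_inv_cancel_left _ _ ((IsUnitUpper.one_sub hL).isUnit_det hr)]
  have hΩ := isBlock_of_mem_symParams hθ
  have hPb : G.IsBlock P := fun u v huv => hP.apply_eq_zero_of_block hr G.component hΩ u v huv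
  have hloc : IsLDL (fun u : G.componentVertices j => r u) (G.restrictCols j w θ.2)
      (G.restrictCols j 1 P) (G.restrictVec j w d) :=
    { tri := fun u v huv => by
        by_cases hv : (v : V) ∈ G.componentCore j
        · rw [restrictCols_apply_of_mem _ _ hv]; exact hP.tri huv
        · rw [restrictCols_apply_of_notMem _ _ hv, if_neg]
          rintro rfl
          exact lt_irrefl _ huv
      diag := fun v => by
        by_cases hv : (v : V) ∈ G.componentCore j
        · rw [restrictCols_apply_of_mem _ _ hv]; exact hP.diag v
        · rw [restrictCols_apply_of_notMem _ _ hv]; simp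
      eq := by
        rw [← restrictCols_diagonal, ← hP.eq, ← restrictCols_transpose hPb,
          ← restrictCols_mul hΩ, ← restrictCols_mul hPb, one_mul, mul_one]
      ne := fun v => by
        by_cases hv : (v : V) ∈ G.componentCore j
        · simpa [restrictVec, hv] using hP.ne v
        · simpa [restrictVec, hv] using hw v hv }
  have := hloc.covarianceMap (hr.comp Subtype.val_injective)
    (apply_eq_zero_of_le (restrictParams_mem_symParams hθ j w)
      fun u v (huv : (G.mixedComponent j).directed u v) => hd u v huv.1)
  rw [hR, ← one_mul (1 : G.componentVertices j → K), restrictCols_mul hPb, restrictCols_one_sub]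
  exact this

/-- Passage from the Σ_j to Σ. The factors of the Ω_j glue to a block diagonal factor of Ω; the
identities are checked after restriction to each V_j, where they are the given ones. -/
theorem isLDL_glueCols [CharZero K] (hr : r.Injective) (hd : ∀ u v, G.directed u v → r u < r v)
    {η : ∀ j, ParamPair (G.componentVertices j) K}
    (hη : ∀ j, η j ∈ (G.mixedComponent j).symParams K)
    {R : ∀ j, Matrix (G.componentVertices j) (G.componentVertices j) K}
    {d : ∀ j, G.componentVertices j → K}
    (h : ∀ j, IsLDL (fun u : G.componentVertices j => r u) (covarianceMap (η j)) (R j) (d j)) :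
    IsLDL r (covarianceMap (G.glue η)) (G.glueCols R) (G.glueVec d) := by
  classical
  have hr' : ∀ j, Function.Injective (fun u : G.componentVertices j => r u) :=
    fun j => hr.comp Subtype.val_injective
  have hL : ∀ j (u v : G.componentVertices j), r v ≤ r u → (η j).1 u v = 0 := fun j =>
    apply_eq_zero_of_le (hη j) fun u v (huv : (G.mixedComponent j).directed u v) => hd u v huv.1
  set P : ∀ j, Matrix (G.componentVertices j) (G.componentVertices j) K :=
    fun j => (1 - (η j).1)⁻¹ * R j with hPdef
  have hP : ∀ j, IsLDL (fun u : G.componentVertices j => r u) (η j).2 (P j) (d j) :=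
    fun j => IsLDL.of_covarianceMap (hr' j) (hL j) (h j)
  have hR : ∀ j, R j = (1 - (η j).1) * P j := fun j => by
    exact (mul_nonsing_inv_cancel_left _ _
      ((IsUnitUpper.one_sub (hL j)).isUnit_det (hr' j))).symm
  have hP0 : ∀ j (u v : G.componentVertices j), u ≠ v →
      ¬ ((u : V) ∈ G.componentCore j ∧ (v : V) ∈ G.componentCore j) → P j u v = 0 := by
    intro j
    -- The blocks of Ω_j are C_j, labelled `none`, and a singleton for each parent outside C_j.
    have key := (hP j).apply_eq_zero_of_block (hr' j)
      (fun u : G.componentVertices j => if (u : V) ∈ G.componentCore j then none else some u)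
      (fun u v huv => apply_eq_zero_of_mem_symParams (hη j) u v (fun e => huv (e ▸ rfl))
        fun hh => huv (by rw [if_pos hh.1, if_pos hh.2]))
    intro u v huv hh
    refine key u v fun e => ?_
    by_cases hu : (u : V) ∈ G.componentCore j <;> by_cases hv : (v : V) ∈ G.componentCore j
    · exact hh ⟨hu, hv⟩
    · simp [hu, hv] at e
    · simp [hu, hv] at e
    · rw [if_neg hu, if_neg hv] at e
      exact huv (Option.some.inj e)
  have hPres : ∀ j, G.restrictCols j 1 (G.glueBlocks P) = P j := fun j =>
    restrictCols_glueBlocks P (hP0 j) fun u _ => (hP j).diag u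
  have hres : ∀ j, G.restrictParams j (fun u => (η j).2 u u) (G.glue η) = η j := fun j =>
    restrictParams_glue j (hη j) fun u _ => rfl
  have hPb : G.IsBlock (G.glueBlocks P) := isBlock_glueBlocks P
  have hΩb : G.IsBlock (G.glue η).2 := isBlock_glueBlocks fun j => (η j).2
  have hbP : ∀ u v (huv : G.component u = G.component v), G.glueBlocks P u v =
      P (G.component v) ⟨u, Or.inl huv⟩ ⟨v, G.mem_componentVertices_self v⟩ := fun u v huv =>
    glueBlocks_apply P ⟨u, Or.inl huv⟩ ⟨v, G.mem_componentVertices_self v⟩ huv rfl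
  have hglue : IsLDL r (G.glue η).2 (G.glueBlocks P) (G.glueVec d) :=
    { tri := fun u v huv => by
        by_cases hc : G.component u = G.component v
        · rw [hbP u v hc]; exact (hP _).tri huv
        · exact hPb u v hc
      diag := fun v => by rw [hbP v v rfl]; exact (hP _).diag _
      eq := by
        refine ((hPb.transpose.mul hΩb).mul hPb).ext (fun u v huv => ?_) fun u v huv => ?_
        · exact diagonal_apply_ne _ fun e => huv (e ▸ rfl)
        · have e1 : G.restrictCols (G.component v)
              (1 * (fun u => (η (G.component v)).2 u u) * 1) ((G.glueBlocks P)ᵀ * (G.glue η).2 *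
              G.glueBlocks P) = diagonal (d (G.component v)) := by
            rw [restrictCols_mul hPb,
              restrictCols_mul hΩb, restrictCols_transpose hPb, hPres,
              show G.restrictCols _ _ (G.glue η).2 = (η (G.component v)).2 from
                congrArg Prod.snd (hres _), (hP _).eq]
          have e2 := congrFun (congrFun e1 ⟨u, Or.inl huv⟩) ⟨v, G.mem_componentVertices_self v⟩
          rw [restrictCols_apply_of_mem (j := G.component v) _ ⟨v, G.mem_componentVertices_self v⟩
            (Eq.refl (G.component v))] at e2
          rw [e2]
          by_cases huv' : u = v
          · subst huv'; rw [diagonal_apply_eq, diagonal_apply_eq]; rfl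
          · rw [diagonal_apply_ne _ huv', diagonal_apply_ne]
            exact fun e => huv' (congrArg Subtype.val e)
      ne := fun v => (hP _).ne _ }
  have hgs := glue_mem_symParams hη
  have hcov := hglue.covarianceMap hr (apply_eq_zero_of_le hgs hd)
  have hcols : (1 - (G.glue η).1) * G.glueBlocks P = G.glueCols R := by
    ext u v
    by_cases hu : u ∈ G.componentVertices (G.component v)
    · have e1 : G.restrictCols (G.component v) (1 * 1) ((1 - (G.glue η).1) * G.glueBlocks P) =
          R (G.component v) := by
        rw [restrictCols_mul hPb, hPres, restrictCols_one_sub,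
          show G.restrictCols _ 0 (G.glue η).1 = (η (G.component v)).1 from
                congrArg Prod.fst (hres _), ← hR]
      have e2 := congrFun (congrFun e1 ⟨u, hu⟩) ⟨v, G.mem_componentVertices_self v⟩
      rw [restrictCols_apply_of_mem (j := G.component v) _ ⟨v, G.mem_componentVertices_self v⟩
            (Eq.refl (G.component v))] at e2
      rw [e2]
      exact (glueCols_apply R ⟨u, hu⟩ ⟨v, G.mem_componentVertices_self v⟩ rfl).symm
    -- For u outside V_j no term survives: u is neither in C_j nor a parent of it, and column v of
    -- the block factor is supported on C_j.
    · rw [glueCols_eq_zero R hu, mul_apply]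
      refine Finset.sum_eq_zero fun x _ => ?_
      by_cases hx : G.component x = G.component v
      · have hux : u ≠ x := by rintro rfl; exact hu (Or.inl hx)
        have : (G.glue η).1 u x = 0 :=
          hgs.1 u x fun hh => hu (Or.inr ⟨x, hx, hh⟩)
        rw [Matrix.sub_apply, one_apply_ne hux, this]
        simp
      · rw [hPb x v hx, mul_zero]
  rw [← hcols]
  exact hcov

/-- Column p of I - Λ is a unit vector, hence so is column p of the inverse. -/
theorem covarianceMap_apply_self_of_source {θ : ParamPair V K} (hu : IsUnit (1 - θ.1)) {p : V}
    (hp : ∀ u, θ.1 u p = 0) : covarianceMap θ p p = θ.2 p p := by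
  have h1 : ∀ u, (1 - θ.1)⁻¹ u p = (1 : Matrix V V K) u p := by
    intro u
    have h := congrFun (congrFun
      (nonsing_inv_mul (1 - θ.1) ((isUnit_iff_isUnit_det _).1 hu)) u) p
    rw [← h, mul_apply, Fintype.sum_eq_single p]
    · simp [hp]
    · intro x hx
      simp [hp, hx]
  simp only [covarianceMap, mul_apply, transpose_apply, h1, one_apply, ite_mul, one_mul, zero_mul,
    mul_ite, mul_one, mul_zero, Finset.sum_ite_eq', Finset.mem_univ, if_true]

end Covariance

end Parameters

end MixedGraph

/-! ### Generic properties in terms of polynomial functions -/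

section ParamAlgebra

/-- The polynomial functions on the space of pairs `(Λ, Ω)`. -/
def paramAlgebra (V K : Type*) [Field K] : Subalgebra K (ParamPair V K → K) :=
  polyAlgebra fun c θ => θ.coords c

theorem snd_mem_paramAlgebra {V K : Type*} [Field K] (u v : V) :
    (fun θ : ParamPair V K => θ.2 u v) ∈ paramAlgebra V K :=
  mem_polyAlgebra_self (fun c (θ : ParamPair V K) => θ.coords c) (Sum.inr (u, v))

/-- A proper algebraic subset lies in the zero locus of one of its equations that is not identically
zero on T, and enlarging the exceptional set is harmless. -/
theorem exists_isProperAlgebraicSubset_iff {V K : Type*} [Field K] {T : Set (ParamPair V K)}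
    {Q : Set (ParamPair V K) → Prop} (hQ : ∀ s t, s ⊆ t → Q t → Q s) :
    (∃ W, IsProperAlgebraicSubset T W ∧ Q (T \ W)) ↔
      ∃ f ∈ paramAlgebra V K, (∃ θ ∈ T, f θ ≠ 0) ∧ Q {θ | θ ∈ T ∧ f θ ≠ 0} := by
  constructor
  · rintro ⟨W, ⟨⟨S, rfl⟩, hne⟩, hW⟩
    have : ∃ θ ∈ T, ∃ p ∈ S, MvPolynomial.eval θ.coords p ≠ 0 := by
      by_contra! hc
      exact hne (Set.Subset.antisymm (fun θ h => h.1) fun θ h => ⟨h, hc θ h⟩)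
    obtain ⟨θ, hθ, p, hp, hpθ⟩ := this
    refine ⟨fun θ : ParamPair V K => MvPolynomial.eval θ.coords p,
      mem_polyAlgebra_iff.2 ⟨p, fun θ => rfl⟩,
      ⟨θ, hθ, hpθ⟩, hQ _ _ ?_ hW⟩
    exact fun θ' h => ⟨h.1, fun h' => h.2 (h'.2 p hp)⟩
  · rintro ⟨f, hf, ⟨θ, hθ, hfθ⟩, h⟩
    obtain ⟨p, hp⟩ := mem_polyAlgebra_iff.1 hf
    refine ⟨{θ | θ ∈ T ∧ ∀ q ∈ ({p} : Set (MvPolynomial ((V × V) ⊕ (V × V)) K)),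
      MvPolynomial.eval θ.coords q = 0}, ⟨⟨{p}, rfl⟩, fun he => ?_⟩, hQ _ _ (fun θ' h' => ?_) h⟩
    · rw [← he] at hθ
      exact hfθ ((hp θ).trans (hθ.2 p rfl))
    · refine ⟨h'.1, fun h0 => h'.2 ⟨h'.1, ?_⟩⟩
      rintro q rfl
      exact (hp θ').symm.trans h0

section

variable {V K : Type*} [Fintype V] [DecidableEq V] [Field K]

theorem isGenericallyToOne_iff {T : Set (ParamPair V K)} {h : ℕ∞} :
    IsGenericallyToOne T h ↔
      HoldsGenerically (paramAlgebra V K) T fun θ => (covarianceFiber T θ).encard = h := by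
  refine (exists_isProperAlgebraicSubset_iff
    (Q := fun s => ∀ θ ∈ s, (covarianceFiber T θ).encard = h)
    fun s t hst ht θ hθ => ht θ (hst hθ)).trans ?_
  simp only [HoldsGenerically, Set.mem_ofPred_eq, and_imp]

theorem MixedGraph.genericallyInfiniteToOne_iff {G : MixedGraph V} :
    G.GenericallyInfiniteToOne ↔ HoldsGenerically (paramAlgebra V ℝ) G.realParams
      fun θ => (covarianceFiber G.realParams θ).encard = ⊤ := by
  rw [← isGenericallyToOne_iff]
  simp only [MixedGraph.GenericallyInfiniteToOne, IsGenericallyToOne, Set.encard_eq_top_iff]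

theorem MixedGraph.genericallyIdentifiable_iff {G : MixedGraph V} :
    G.GenericallyIdentifiable ↔ SeparatesGenerically (paramAlgebra V ℝ) G.realParams
      (covarianceFiber G.realParams) := by
  refine (exists_isProperAlgebraicSubset_iff (Q := fun s => Set.InjOn covarianceMap s)
    fun s t hst ht => ht.mono hst).trans ?_
  refine exists_congr fun f => and_congr_right fun _ => and_congr_right fun _ => ?_
  constructor
  · intro h θ hθ hf θ' hθ' hf' hF
    exact h ⟨hθ', hf'⟩ ⟨hθ, hf⟩ hF.2
  · intro h θ hθ θ' hθ' he
    exact h θ' hθ'.1 hθ'.2 θ hθ.1 hθ.2 ⟨hθ.1, he⟩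

/-- In this form rationality can be followed through matrix computations without naming numerators
and denominators. -/
theorem MixedGraph.rationallyIdentifiable_iff {G : MixedGraph V} :
    G.RationallyIdentifiable ↔ ∃ f ∈ paramAlgebra V ℝ, (∃ θ ∈ G.realParams, f θ ≠ 0) ∧
      ∀ c, (fun θ : {θ // θ ∈ G.realParams ∧ f θ ≠ 0} => θ.1.coords c) ∈ fracAlgebra
        (polyAlgebra fun (e : V × V) (θ : {θ // θ ∈ G.realParams ∧ f θ ≠ 0}) =>
          covarianceMap θ.1 e.1 e.2) := by
  refine (exists_isProperAlgebraicSubset_iff (Q := fun s =>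
    ∃ num den : (V × V) ⊕ (V × V) → MvPolynomial (V × V) ℝ, ∀ θ ∈ s, ∀ i,
        MvPolynomial.eval (fun e => covarianceMap θ e.1 e.2) (den i) ≠ 0 ∧
        MvPolynomial.eval (fun e => covarianceMap θ e.1 e.2) (num i) /
          MvPolynomial.eval (fun e => covarianceMap θ e.1 e.2) (den i) = θ.coords i)
    fun s t hst ⟨num, den, h⟩ => ⟨num, den, fun θ hθ => h θ (hst hθ)⟩).trans ?_
  refine exists_congr fun f => and_congr_right fun _ => and_congr_right fun _ => ?_
  constructor
  · rintro ⟨num, den, h⟩ c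
    exact ⟨_, mem_polyAlgebra_iff.2 ⟨num c, fun _ => rfl⟩, _,
      mem_polyAlgebra_iff.2 ⟨den c, fun _ => rfl⟩, fun θ => h θ.1 θ.2 c⟩
  · intro h
    choose n hn d hd hnd using h
    choose num hnum using fun c => mem_polyAlgebra_iff.1 (hn c)
    choose den hden using fun c => mem_polyAlgebra_iff.1 (hd c)
    refine ⟨num, den, fun θ hθ c => ?_⟩
    have := hnd c ⟨θ, hθ⟩
    rwa [hnum, hden] at this

end

/-- A polynomial function and a principal minor function that are not identically zero on a set
that contains the segment to `(0, 1)` have a common nonzero point. -/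
theorem exists_ne_and_minorProd_ne {V K : Type*} [Fintype V] [DecidableEq V] [Field K]
    [Infinite K] {r : V → ℕ} {T : Set (ParamPair V K)}
    (hT : ∀ θ ∈ T, ∀ t : K, ((1 - t) • θ.1, (1 - t) • θ.2 + t • (1 : Matrix V V K)) ∈ T)
    {f : ParamPair V K → K} (hf : f ∈ paramAlgebra V K) (h : ∃ θ ∈ T, f θ ≠ 0) :
    ∃ θ ∈ T, f θ ≠ 0 ∧ minorProd r θ.2 ≠ 0 := by
  obtain ⟨θ, hθ, hfθ⟩ := h
  set γ : K → ParamPair V K := fun t =>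
    ((1 - t) • θ.1, (1 - t) • θ.2 + t • (1 : Matrix V V K)) with hγ
  set B : Subalgebra K (K → K) := polyAlgebra fun (_ : Unit) (t : K) => t with hB
  have hid : (fun t : K => t) ∈ B := mem_polyAlgebra_self (fun (_ : Unit) (t : K) => t) ()
  have h1t : (fun t : K => 1 - t) ∈ B := B.sub_mem (const_mem B 1) hid
  have hγ2 : ∀ u v, (fun t => (γ t).2 u v) ∈ B := fun u v => by
    simp only [hγ, Matrix.add_apply, Matrix.smul_apply, smul_eq_mul]
    exact B.add_mem (B.mul_mem h1t (const_mem B _)) (B.mul_mem hid (const_mem B _))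
  have hfγ : (fun t => f (γ t)) ∈ B := by
    refine comp_mem_of_mem_polyAlgebra (fun c => ?_) hf
    rcases c with ⟨u, v⟩ | ⟨u, v⟩
    · exact B.mul_mem h1t (const_mem B _)
    · exact hγ2 u v
  have hm : (fun t => minorProd r (γ t).2) ∈ B := minorProd_mem hγ2
  obtain ⟨p, hp⟩ := mem_polyAlgebra_iff.1 hfγ
  obtain ⟨q, hq⟩ := mem_polyAlgebra_iff.1 hm
  -- Along the segment, f is nonzero at t = 0 and the minors of the identity equal 1 at t = 1; a
  -- product of two nonzero polynomials over an infinite field is nonzero at some t.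
  have hp0 : p ≠ 0 := by
    rintro rfl
    have := hp 0
    simp only [hγ, map_zero] at this
    exact hfθ (by simpa using this)
  have hq0 : q ≠ 0 := by
    rintro rfl
    have := hq 1
    simp [hγ, minorProd, Matrix.submatrix_one _ Subtype.val_injective] at this
  have : ∃ x : Unit → K, MvPolynomial.eval x (p * q) ≠ 0 := by
    by_contra! hc
    exact mul_ne_zero hp0 hq0 (MvPolynomial.funext fun x => by rw [hc, map_zero])
  obtain ⟨x, hx⟩ := this
  rw [map_mul] at hx
  obtain ⟨hx1, hx2⟩ := mul_ne_zero_iff.1 hx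
  exact ⟨γ (x ()), hT θ hθ _, fun h => hx1 ((hp (x ())).symm.trans h),
    fun h => hx2 ((hq (x ())).symm.trans h)⟩

end ParamAlgebra

/-! ### Topological order and the product decomposition of fibers -/

namespace MixedGraph

theorem Acyclic.exists_rank {V : Type*} [Fintype V] {G : MixedGraph V} (hG : G.Acyclic) :
    ∃ r : V → ℕ, r.Injective ∧ ∀ u v, G.directed u v → r u < r v := by
  classical
  set N := Fintype.card V with hN
  let e := Fintype.equivFin V
  let c : V → ℕ := fun v => (Finset.univ.filter fun u => Relation.TransGen G.directed u v).card
  -- The number of proper ancestors grows along edges; an enumeration below N breaks ties and is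
  -- recovered modulo N.
  refine ⟨fun v => e v + N * c v, fun u v huv => ?_, fun u v huv => ?_⟩
  · have h := congrArg (· % N) huv
    simp only [Nat.add_mul_mod_self_left] at h
    rw [Nat.mod_eq_of_lt (e u).isLt, Nat.mod_eq_of_lt (e v).isLt] at h
    exact e.injective (Fin.ext h)
  · have hc : c u < c v := by
      refine Finset.card_lt_card (Finset.ssubset_iff_of_subset ?_ |>.2 ⟨u, ?_, ?_⟩)
      · intro x hx
        simp only [Finset.mem_filter, Finset.mem_univ, true_and] at hx ⊢
        exact hx.tail huv
      · simpa using Relation.TransGen.single huv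
      · simpa using hG u
    have h1 : (e u : ℕ) < N := (e u).isLt
    have h2 : N * (c u + 1) ≤ N * c v := Nat.mul_le_mul_left N hc
    show (e u : ℕ) + N * c u < e v + N * c v
    rw [mul_add] at h2
    omega

section Splitting

set_option linter.unusedSectionVars false

variable {V K : Type*} [Fintype V] [DecidableEq V] [Field K] {G : MixedGraph V}

theorem glue_coords_mem {X : Type*} {B : Subalgebra K (X → K)}
    {η : ∀ j, X → ParamPair (G.componentVertices j) K}
    (h : ∀ j c, (fun x => (η j x).coords c) ∈ B) (c : (V × V) ⊕ (V × V)) :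
    (fun x => (G.glue fun j => η j x).coords c) ∈ B := by
  classical
  have h1 : ∀ j u v, (fun x => (η j x).1 u v) ∈ B := fun j u v => h j (Sum.inl (u, v))
  have h2 : ∀ j u v, (fun x => (η j x).2 u v) ∈ B := fun j u v => h j (Sum.inr (u, v))
  rcases c with ⟨u, v⟩ | ⟨u, v⟩
  · simp only [ParamPair.coords, Sum.elim_inl, glue, glueCols, extendZero]
    split_ifs
    · exact h1 _ _ _
    · exact const_mem B 0
  · simp only [ParamPair.coords, Sum.elim_inr, glue, glueBlocks, extendZero]
    split_ifs
    · exact h2 _ _ _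
    · exact const_mem B 0
    · exact const_mem B 0

theorem restrictCols_mem {X : Type*} {B : Subalgebra K (X → K)} {j : G.ComponentIndex}
    {w : X → G.componentVertices j → K} {M : X → Matrix V V K}
    (hw : ∀ u : G.componentVertices j, (u : V) ∉ G.componentCore j → (fun x => w x u) ∈ B)
    (h : ∀ u v, (fun x => M x u v) ∈ B) (u v : G.componentVertices j) :
    (fun x => G.restrictCols j (w x) (M x) u v) ∈ B := by
  classical
  simp only [restrictCols]
  split_ifs with h1 h2
  · exact h _ _
  · exact hw u (h2 ▸ h1)
  · exact const_mem B 0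

theorem restrictParams_coords_mem {X : Type*} {B : Subalgebra K (X → K)} {j : G.ComponentIndex}
    {w : X → G.componentVertices j → K} {θ : X → ParamPair V K}
    (hw : ∀ u : G.componentVertices j, (u : V) ∉ G.componentCore j → (fun x => w x u) ∈ B)
    (h : ∀ c, (fun x => (θ x).coords c) ∈ B) (c) :
    (fun x => (G.restrictParams j (w x) (θ x)).coords c) ∈ B := by
  rcases c with ⟨u, v⟩ | ⟨u, v⟩
  · exact restrictCols_mem (w := fun _ => 0) (fun u _ => const_mem B 0)
      (fun u v => h (Sum.inl (u, v))) u v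
  · exact restrictCols_mem hw (fun u v => h (Sum.inr (u, v))) u v

variable {r : V → ℕ}

/-- A parent outside C_j is a source of G_j, so its variance is an entry of the covariance matrix.
-/
theorem diag_eq_of_covarianceMap_eq (hr : r.Injective) (hd : ∀ u v, G.directed u v → r u < r v)
    {j : G.ComponentIndex} {y y' : ParamPair (G.componentVertices j) K}
    (hy : y ∈ (G.mixedComponent j).symParams K) (hy' : y' ∈ (G.mixedComponent j).symParams K)
    (h : covarianceMap y = covarianceMap y') (p : G.componentVertices j)
    (hp : (p : V) ∉ G.componentCore j) : y.2 p p = y'.2 p p := by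
  have key : ∀ z ∈ (G.mixedComponent j).symParams K, covarianceMap z p p = z.2 p p :=
    fun z hz => covarianceMap_apply_self_of_source
      ((IsUnitUpper.one_sub (r := fun u : G.componentVertices j => r u)
        (apply_eq_zero_of_le hz fun u v huv => hd u v huv.1)).isUnit
          (hr.comp Subtype.val_injective))
      fun u => hz.1 u p fun hh => hp hh.2
  rw [← key y hy, h, key y' hy']

theorem diag_ne_zero_of_det_ne_zero {j : G.ComponentIndex}
    {y : ParamPair (G.componentVertices j) K} (hy : y ∈ (G.mixedComponent j).symParams K)
    (h : y.2.det ≠ 0) (p : G.componentVertices j) (hp : (p : V) ∉ G.componentCore j) :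
    y.2 p p ≠ 0 := fun h0 => h <| det_eq_zero_of_row_eq_zero p fun v => by
  by_cases hv : p = v
  · subst hv; exact h0
  · exact apply_eq_zero_of_mem_symParams hy p v hv fun hh => hp hh.1

variable [CharZero K]

/-- A matrix is determined by its decomposition. Equal Σ_j give equal glued factors, hence equal Σ,
and equal Σ give equal restricted factors. The inverse of gluing is restriction with the parent
variances of η, which are shared by the whole fiber. -/
theorem bijOn_glue (hr : r.Injective) (hd : ∀ u v, G.directed u v → r u < r v)
    {T : Set (ParamPair V K)} {T' : ∀ j, Set (ParamPair (G.componentVertices j) K)}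
    (hT : T ⊆ G.symParams K) (hT' : ∀ j, T' j ⊆ (G.mixedComponent j).symParams K)
    (hglue : ∀ η, (∀ j, η j ∈ T' j) → G.glue η ∈ T)
    (hres : ∀ θ ∈ T, ∀ η : ∀ j, ParamPair (G.componentVertices j) K, (∀ j, η j ∈ T' j) → ∀ j,
      G.restrictParams j (fun u => (η j).2 u u) θ ∈ T' j)
    {η : ∀ j, ParamPair (G.componentVertices j) K} (hη : ∀ j, η j ∈ T' j)
    (he : ∀ j, minorProd (fun u : G.componentVertices j => r u) (η j).2 ≠ 0) :
    Set.BijOn G.glue (Set.pi Set.univ fun j => covarianceFiber (T' j) (η j))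
      (covarianceFiber T (G.glue η)) := by
  have hr' : ∀ j, Function.Injective (fun u : G.componentVertices j => r u) :=
    fun j => hr.comp Subtype.val_injective
  have hs := fun j => hT' j (hη j)
  have hloc : ∀ j, ∃ R d, IsLDL (fun u : G.componentVertices j => r u)
      (covarianceMap (η j)) R d := fun j =>
    ⟨_, _, (isLDL_ldlFactor (hr' j) (hs j).2.1 (he j)).covarianceMap (hr' j)
      (apply_eq_zero_of_le (hs j) fun u v huv => hd u v huv.1)⟩
  choose R d hRd using hloc
  have hg := isLDL_glueCols hr hd hs hRd
  have hrec : ∀ η', (∀ j, η' j ∈ covarianceFiber (T' j) (η j)) → ∀ j,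
      G.restrictParams j (fun u => (η j).2 u u) (G.glue η') = η' j := fun η' h j =>
    restrictParams_glue j (hT' j (h j).1) fun u hu =>
      diag_eq_of_covarianceMap_eq hr hd (hT' j (h j).1) (hs j) (h j).2 u hu
  refine ⟨fun η' hη' => ?_, fun η' hη' η'' hη'' h => ?_, fun θ hθ => ?_⟩
  · have hη'F := fun j => hη' j (Set.mem_univ j)
    refine ⟨hglue η' fun j => (hη'F j).1, ?_⟩
    have hRd' : ∀ j, IsLDL (fun u : G.componentVertices j => r u)
        (covarianceMap (η' j)) (R j) (d j) := fun j => by rw [(hη'F j).2]; exact hRd j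
    exact (isLDL_glueCols hr hd (fun j => hT' j (hη'F j).1) hRd').eq_of_eq hr hg
  · funext j
    rw [← hrec η' (fun j => hη' j (Set.mem_univ j)) j,
      ← hrec η'' (fun j => hη'' j (Set.mem_univ j)) j, h]
  · refine ⟨fun j => G.restrictParams j (fun u => (η j).2 u u) θ, fun j _ =>
      ⟨hres θ hθ.1 η hη j, ?_⟩, glue_restrictParams (hT hθ.1) _⟩
    have hw := diag_ne_zero_of_det_ne_zero (hs j) (mul_ne_zero_iff.1 (he j)).1
    have h1 := isLDL_restrictCols hr hd (hT hθ.1) (hθ.2.symm ▸ hg) j hw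
    have h2 := isLDL_restrictCols hr hd (glue_mem_symParams hs) hg j hw
    rw [restrictParams_glue j (hs j) fun _ _ => rfl] at h2
    exact h1.eq_of_eq (hr' j) h2

theorem fiberSplitting [DecidableEq G.ComponentIndex] (hr : r.Injective)
    (hd : ∀ u v, G.directed u v → r u < r v)
    {T : Set (ParamPair V K)} {T' : ∀ j, Set (ParamPair (G.componentVertices j) K)}
    (hT : T ⊆ G.symParams K) (hT' : ∀ j, T' j ⊆ (G.mixedComponent j).symParams K)
    (hglue : ∀ η, (∀ j, η j ∈ T' j) → G.glue η ∈ T)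
    (hres : ∀ θ ∈ T, ∀ η : ∀ j, ParamPair (G.componentVertices j) K, (∀ j, η j ∈ T' j) → ∀ j,
      G.restrictParams j (fun u => (η j).2 u u) θ ∈ T' j)
    (hne : ∀ j, ∀ f ∈ paramAlgebra (G.componentVertices j) K, (∃ y ∈ T' j, f y ≠ 0) →
      ∃ y ∈ T' j, f y ≠ 0 ∧ minorProd (fun u : G.componentVertices j => r u) y.2 ≠ 0)
    (hnonempty : ∀ j, (T' j).Nonempty) :
    FiberSplitting (paramAlgebra V K) (fun j => paramAlgebra (G.componentVertices j) K) T T'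
      (covarianceFiber T) (fun j => covarianceFiber (T' j)) G.glue
      (fun j y => minorProd (fun u : G.componentVertices j => r u) y.2) where
  glue_mem := hglue
  comp_update f hf η i := by
    refine comp_mem_of_mem_polyAlgebra
      (t := fun y => G.glue (Function.update η i y)) (glue_coords_mem fun j c => ?_) hf
    by_cases hj : j = i
    · subst hj
      simp only [Function.update_self]
      exact mem_polyAlgebra_self (fun c (θ : ParamPair (G.componentVertices j) K) => θ.coords c) c
    · simp only [Function.update_of_ne hj]
      exact const_mem _ _
  e_mem j := minorProd_mem fun u v => snd_mem_paramAlgebra u v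
  exists_ne := hne
  nonempty := hnonempty
  exists_res η₀ hη₀ := by
    refine ⟨fun j => G.restrictParams j fun u => (η₀ j).2 u u, fun j f hf => ?_, fun j => ?_,
      fun θ hθ => ⟨hres θ hθ η₀ hη₀, glue_restrictParams (hT hθ) _⟩, fun θ hθ η hη j => ?_⟩
    · refine comp_mem_of_mem_polyAlgebra
        (t := G.restrictParams j fun u => (η₀ j).2 u u)
        (restrictParams_coords_mem (θ := fun θ => θ) (w := fun _ u => (η₀ j).2 u u)
        (fun u _ => const_mem _ _) fun c => ?_) hf
      exact mem_polyAlgebra_self (fun c (θ : ParamPair V K) => θ.coords c) c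
    · exact restrictParams_glue j (hT' j (hη₀ j)) fun _ _ => rfl
    · refine restrictParams_glue j (hT' j (hη j).1) fun u hu => ?_
      rw [diag_eq_of_covarianceMap_eq hr hd (hT' j (hη j).1)
        (restrictParams_mem_symParams (hT hθ) j _) (hη j).2 u hu]
      exact (restrictCols_apply_of_notMem _ _ hu).trans (if_pos rfl)
  bijOn _ hη he := bijOn_glue hr hd hT hT' hglue hres hη he
  fiber_subset _ _ _ h := h.1
  mem_fiber _ _ h := ⟨h, rfl⟩

end Splitting

end MixedGraph

namespace MixedGraph

/-! ### Positive definiteness through the triangular decomposition -/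

section PosDef

variable {V : Type*} [Fintype V] [DecidableEq V] {r : V → ℕ}

/-- Congruence by an invertible matrix preserves positive definiteness. Gluing and restriction
rearrange d, apart from the prescribed parent variances, so they preserve positivity. -/
theorem isLDL_posDef_iff (hr : r.Injective) {S R : Matrix V V ℝ} {d : V → ℝ}
    (h : IsLDL r S R d) : S.PosDef ↔ ∀ v, 0 < d v := by
  constructor
  · intro hS
    have h1 := hS.conjTranspose_mul_mul_same
      (mulVec_injective_of_isUnit (h.toIsUnitUpper.isUnit hr))
    rw [conjTranspose_eq_transpose_of_trivial, h.eq] at h1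
    exact posDef_diagonal_iff.1 h1
  · intro hd
    have h1 := (posDef_diagonal_iff.2 hd).conjTranspose_mul_mul_same
      (mulVec_injective_of_isUnit ((h.toIsUnitUpper.inv hr).isUnit hr))
    rwa [conjTranspose_eq_transpose_of_trivial, ← h.eq_inv hr] at h1

theorem _root_.Matrix.PosDef.isSymm {S : Matrix V V ℝ} (hS : S.PosDef) : S.IsSymm := by
  have := hS.isHermitian
  rwa [IsHermitian, conjTranspose_eq_transpose_of_trivial] at this

theorem isUnit_one_sub_of_mem_symParams {K : Type*} [Field K] {H : MixedGraph V}
    (hr : r.Injective) (hd : ∀ u v, H.directed u v → r u < r v) {θ : ParamPair V K}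
    (hθ : θ ∈ H.symParams K) : IsUnit (1 - θ.1) :=
  (IsUnitUpper.one_sub (apply_eq_zero_of_le hθ hd)).isUnit hr

theorem mem_realParams_iff {H : MixedGraph V} (hr : r.Injective)
    (hd : ∀ u v, H.directed u v → r u < r v) {θ : ParamPair V ℝ} :
    θ ∈ H.realParams ↔ θ ∈ H.symParams ℝ ∧ θ.2.PosDef :=
  ⟨fun h => ⟨⟨h.1.1, h.2.1.isSymm, h.2.2⟩, h.2.1⟩,
    fun h => ⟨⟨h.1.1, isUnit_one_sub_of_mem_symParams hr hd h.1⟩, h.2, h.1.2.2⟩⟩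

theorem complexParams_eq {H : MixedGraph V} (hr : r.Injective)
    (hd : ∀ u v, H.directed u v → r u < r v) : H.complexParams = H.symParams ℂ :=
  Set.ext fun _ => ⟨fun h => ⟨h.1.1, h.2.1, h.2.2⟩,
    fun h => ⟨⟨h.1, isUnit_one_sub_of_mem_symParams hr hd h⟩, h.2.1, h.2.2⟩⟩

theorem isLDL_of_posDef (hr : r.Injective) {H : MixedGraph V}
    (hd : ∀ u v, H.directed u v → r u < r v) {θ : ParamPair V ℝ} (hθ : θ ∈ H.symParams ℝ)
    (h : θ.2.PosDef) : ∃ R d, IsLDL r (covarianceMap θ) R d ∧ ∀ v, 0 < d v := by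
  have h1 := isLDL_ldlFactor hr h.isSymm h.minorProd_pos.ne'
  exact ⟨_, _, h1.covarianceMap hr (apply_eq_zero_of_le hθ hd), (isLDL_posDef_iff hr h1).1 h⟩

theorem posDef_of_isLDL (hr : r.Injective) {H : MixedGraph V}
    (hd : ∀ u v, H.directed u v → r u < r v) {θ : ParamPair V ℝ} (hθ : θ ∈ H.symParams ℝ)
    {R : Matrix V V ℝ} {d : V → ℝ} (h : IsLDL r (covarianceMap θ) R d) (h0 : ∀ v, 0 < d v) :
    θ.2.PosDef :=
  (isLDL_posDef_iff hr (IsLDL.of_covarianceMap hr (apply_eq_zero_of_le hθ hd) h)).2 h0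

theorem posDef_covarianceMap {H : MixedGraph V} {θ : ParamPair V ℝ} (hθ : θ ∈ H.realParams) :
    (covarianceMap θ).PosDef := by
  have h := hθ.2.1.conjTranspose_mul_mul_same
    (mulVec_injective_of_isUnit (A := (1 - θ.1)⁻¹) ((isUnit_nonsing_inv_iff).2 hθ.1.2))
  rwa [conjTranspose_eq_transpose_of_trivial] at h

theorem zero_one_mem_symParams (H : MixedGraph V) (K : Type*) [Field K] :
    ((0, 1) : ParamPair V K) ∈ H.symParams K :=
  ⟨fun _ _ _ => rfl, isSymm_one, fun _ _ h _ => one_apply_ne h⟩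

end PosDef

/-! ### The real and complex parameter spaces and the degree of identifiability -/

section Main

variable {V : Type*} [Fintype V] [DecidableEq V] {G : MixedGraph V} {r : V → ℕ}

theorem glue_mem_realParams (hr : r.Injective) (hd : ∀ u v, G.directed u v → r u < r v)
    {η : ∀ j, ParamPair (G.componentVertices j) ℝ}
    (hη : ∀ j, η j ∈ (G.mixedComponent j).realParams) : G.glue η ∈ G.realParams := by
  have hr' : ∀ j, Function.Injective (fun u : G.componentVertices j => r u) :=
    fun j => hr.comp Subtype.val_injective
  have hd' : ∀ j u v, (G.mixedComponent j).directed u v → r u < r v := fun j u v h => hd u v h.1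
  have hs := fun j => (mem_realParams_iff (hr' j) (hd' j)).1 (hη j)
  choose R d hRd hpos using fun j => isLDL_of_posDef (hr' j) (hd' j) (hs j).1 (hs j).2
  have hg := glue_mem_symParams fun j => (hs j).1
  exact (mem_realParams_iff hr hd).2 ⟨hg, posDef_of_isLDL hr hd hg
    (isLDL_glueCols hr hd (fun j => (hs j).1) hRd) fun v => hpos _ _⟩

theorem restrictParams_mem_realParams (hr : r.Injective)
    (hd : ∀ u v, G.directed u v → r u < r v) {θ : ParamPair V ℝ} (hθ : θ ∈ G.realParams)
    (j : G.ComponentIndex) {w : G.componentVertices j → ℝ}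
    (hw : ∀ u : G.componentVertices j, (u : V) ∉ G.componentCore j → 0 < w u) :
    G.restrictParams j w θ ∈ (G.mixedComponent j).realParams := by
  have hr' : Function.Injective (fun u : G.componentVertices j => r u) :=
    hr.comp Subtype.val_injective
  have hd' : ∀ u v, (G.mixedComponent j).directed u v → r u < r v := fun u v h => hd u v h.1
  have hs := (mem_realParams_iff hr hd).1 hθ
  obtain ⟨R, d, hRd, hpos⟩ := isLDL_of_posDef hr hd hs.1 hs.2
  have hg := restrictParams_mem_symParams hs.1 j w
  refine (mem_realParams_iff hr' hd').2 ⟨hg, posDef_of_isLDL hr' hd' hg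
    (isLDL_restrictCols hr hd hs.1 hRd j fun u hu => (hw u hu).ne') fun v => ?_⟩
  by_cases hv : (v : V) ∈ G.componentCore j
  · simpa [restrictVec, hv] using hpos v
  · simpa [restrictVec, hv] using hw v hv

theorem fiberSplitting_realParams [DecidableEq G.ComponentIndex] (hr : r.Injective)
    (hd : ∀ u v, G.directed u v → r u < r v) :
    FiberSplitting (paramAlgebra V ℝ) (fun j => paramAlgebra (G.componentVertices j) ℝ)
      G.realParams (fun j => (G.mixedComponent j).realParams) (covarianceFiber G.realParams)
      (fun j => covarianceFiber (G.mixedComponent j).realParams) G.glue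
      (fun j y => minorProd (fun u : G.componentVertices j => r u) y.2) := by
  have hr' : ∀ j, Function.Injective (fun u : G.componentVertices j => r u) :=
    fun j => hr.comp Subtype.val_injective
  have hd' : ∀ j u v, (G.mixedComponent j).directed u v → r u < r v := fun j u v h => hd u v h.1
  exact fiberSplitting hr hd (fun θ hθ => ((mem_realParams_iff hr hd).1 hθ).1)
    (fun j θ hθ => ((mem_realParams_iff (hr' j) (hd' j)).1 hθ).1)
    (fun η hη => glue_mem_realParams hr hd hη)
    (fun θ hθ η hη j => restrictParams_mem_realParams hr hd hθ j fun u _ => (hη j).2.1.diag_pos)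
    (fun j f _ ⟨y, hy, hfy⟩ => ⟨y, hy, hfy, hy.2.1.minorProd_pos.ne'⟩)
    (fun j => ⟨(0, 1), (mem_realParams_iff (hr' j) (hd' j)).2
      ⟨zero_one_mem_symParams _ ℝ, PosDef.one⟩⟩)

theorem fiberSplitting_complexParams [DecidableEq G.ComponentIndex] (hr : r.Injective)
    (hd : ∀ u v, G.directed u v → r u < r v) :
    FiberSplitting (paramAlgebra V ℂ) (fun j => paramAlgebra (G.componentVertices j) ℂ)
      G.complexParams (fun j => (G.mixedComponent j).complexParams)
      (covarianceFiber G.complexParams)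
      (fun j => covarianceFiber (G.mixedComponent j).complexParams) G.glue
      (fun j y => minorProd (fun u : G.componentVertices j => r u) y.2) := by
  have hr' : ∀ j, Function.Injective (fun u : G.componentVertices j => r u) :=
    fun j => hr.comp Subtype.val_injective
  have hd' : ∀ j u v, (G.mixedComponent j).directed u v → r u < r v := fun j u v h => hd u v h.1
  have he : ∀ j, (G.mixedComponent j).complexParams = (G.mixedComponent j).symParams ℂ :=
    fun j => complexParams_eq (hr' j) (hd' j)
  -- Invertibility of I - Λ is automatic for acyclic graphs, so these are linear spaces containing
  -- (0, 1) and hence the segments to it.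
  simp only [complexParams_eq hr hd, he]
  refine fiberSplitting hr hd subset_rfl (fun j => subset_rfl) (fun η hη => glue_mem_symParams hη)
    (fun θ hθ η _ j => restrictParams_mem_symParams hθ j _)
    (fun j f hf h => exists_ne_and_minorProd_ne (fun y hy t => ?_) hf h)
    (fun j => ⟨(0, 1), zero_one_mem_symParams _ ℂ⟩)
  refine ⟨fun u v huv => ?_, ?_, fun u v huv hadj => ?_⟩
  · simp [hy.1 u v huv]
  · exact (hy.2.1.smul _).add (isSymm_one.smul _)
  · simp [hy.2.2 u v huv hadj, huv]

/-- Since inf ∅ = ∞, the equality needs no existence of a generic cardinality: a finite degree is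
attained, and a finite generic cardinality for G factors into ones for the G_j. Degrees are nonzero
because a fiber contains its base point, so an infinite factor makes the product infinite. -/
theorem prod_identifiabilityDegree (hr : r.Injective) (hd : ∀ u v, G.directed u v → r u < r v) :
    G.identifiabilityDegree = ∏ j, (G.mixedComponent j).identifiabilityDegree := by
  classical
  have H := fiberSplitting_complexParams hr hd
  have hne : ∀ j, (G.mixedComponent j).identifiabilityDegree ≠ 0 := fun j h0 => by
    have hmem : (0 : ℕ∞) ∈ {h : ℕ∞ | IsGenericallyToOne (G.mixedComponent j).complexParams h} := by
      rw [← h0]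
      refine csInf_mem (Set.nonempty_iff_ne_empty.2 fun he => ?_)
      rw [identifiabilityDegree, he, sInf_empty] at h0
      exact ENat.top_ne_zero h0
    obtain ⟨f, -, ⟨y, hy, hfy⟩, hQ⟩ := isGenericallyToOne_iff.1 hmem
    exact H.encard_fiber_ne_zero hy (hQ y hy hfy)
  refine le_antisymm ?_ (le_sInf fun h hh => ?_)
  · by_cases htop : ∃ j, (G.mixedComponent j).identifiabilityDegree = ⊤
    · obtain ⟨j, hj⟩ := htop
      exact le_top.trans_eq (WithTop.prod_eq_top (Finset.mem_univ j) hj fun i _ => hne i).symm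
    · push Not at htop
      refine sInf_le (isGenericallyToOne_iff.2 (H.prod_of_generically fun j => ?_))
      refine isGenericallyToOne_iff.1
        (csInf_mem (s := {h : ℕ∞ | IsGenericallyToOne (G.mixedComponent j).complexParams h})
          (Set.nonempty_iff_ne_empty.2 fun he => htop j ?_))
      rw [identifiabilityDegree, he, sInf_empty]
  · by_cases htop : h = ⊤
    · rw [htop]; exact le_top
    · obtain ⟨h', rfl, hh'⟩ :=
        H.exists_generically_of_prod htop (isGenericallyToOne_iff.1 hh)
      exact Finset.prod_le_prod' fun j _ => sInf_le (isGenericallyToOne_iff.2 (hh' j))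

/-! ### Rational identifiability -/

/-- The entries of `S` are rational in the entries of a decomposition. -/
theorem apply_mem_of_isLDL {W K X : Type*} [Fintype W] [DecidableEq W] [Field K] {r : W → ℕ}
    (hr : r.Injective) {B : Subalgebra K (X → K)} (hB : B.InvClosed) {S R : X → Matrix W W K}
    {d : X → W → K} (h : ∀ x, IsLDL r (S x) (R x) (d x))
    (hR : ∀ u v, (fun x => R x u v) ∈ B) (hd : ∀ v, (fun x => d x v) ∈ B) (u v : W) :
    (fun x => S x u v) ∈ B := by
  have hinv := matrix_inv_mem hB hR fun x => by
    rw [(h x).det_eq_one hr]; exact one_ne_zero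
  simp only [fun x => (h x).eq_inv hr]
  refine matrix_mul_mem (matrix_mul_mem (fun i j => hinv j i) fun i j => ?_) hinv u v
  by_cases hij : i = j
  · subst hij; simpa only [diagonal_apply_eq] using hd i
  · simp only [diagonal_apply_ne _ hij]; exact const_mem B 0

/-- The factors of the decomposition are rational in the entries of a positive definite matrix. -/
theorem exists_isLDL_mem {W X : Type*} [Fintype W] [DecidableEq W] {r : W → ℕ}
    (hr : r.Injective) {B : Subalgebra ℝ (X → ℝ)} (hB : B.InvClosed) {S : X → Matrix W W ℝ}
    (hS : ∀ x, (S x).PosDef) (h : ∀ u v, (fun x => S x u v) ∈ B) :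
    ∃ (R : X → Matrix W W ℝ) (d : X → W → ℝ), (∀ x, IsLDL r (S x) (R x) (d x)) ∧
      (∀ u v, (fun x => R x u v) ∈ B) ∧
      ∀ v, (fun x => d x v) ∈ B := by
  have hR := ldlFactor_mem (r := r) hB h fun x => (hS x).minorProd_pos.ne'
  exact ⟨fun x => ldlFactor r (S x),
    fun x v => ((ldlFactor r (S x))ᵀ * S x * ldlFactor r (S x)) v v,
    fun x => isLDL_ldlFactor hr (hS x).isSymm (hS x).minorProd_pos.ne', hR,
    fun v => matrix_mul_mem (matrix_mul_mem (fun i j => hR j i) h) hR v v⟩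

/-- Σ_j is obtained rationally from Σ by decomposing, restricting the factors and multiplying out.
-/
theorem covarianceMap_restrictParams_mem (hr : r.Injective)
    (hd : ∀ u v, G.directed u v → r u < r v) {X : Type*} {B : Subalgebra ℝ (X → ℝ)}
    (hB : B.InvClosed) {θ : X → ParamPair V ℝ} (hθ : ∀ x, θ x ∈ G.realParams)
    (h : ∀ u v, (fun x => covarianceMap (θ x) u v) ∈ B) {j : G.ComponentIndex}
    {w : G.componentVertices j → ℝ} (hw : ∀ u, 0 < w u) (u v : G.componentVertices j) :
    (fun x => covarianceMap (G.restrictParams j w (θ x)) u v) ∈ B := by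
  classical
  obtain ⟨R, d, hRd, hR, hdB⟩ := exists_isLDL_mem hr hB (fun x => posDef_covarianceMap (hθ x)) h
  refine apply_mem_of_isLDL (hr.comp Subtype.val_injective) hB
    (fun x => isLDL_restrictCols hr hd ((mem_realParams_iff hr hd).1 (hθ x)).1 (hRd x) j
      fun u _ => (hw u).ne')
    (restrictCols_mem (fun u _ => const_mem B 1) hR) (fun v => ?_) u v
  simp only [restrictVec]
  exact ite_fun_mem (fun _ => hdB _) fun _ => const_mem B _

theorem covarianceMap_glue_mem (hr : r.Injective)
    (hd : ∀ u v, G.directed u v → r u < r v) {X : Type*} {B : Subalgebra ℝ (X → ℝ)}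
    (hB : B.InvClosed) {η : X → ∀ j, ParamPair (G.componentVertices j) ℝ}
    (hη : ∀ x j, η x j ∈ (G.mixedComponent j).realParams)
    (h : ∀ j u v, (fun x => covarianceMap (η x j) u v) ∈ B) (u v : V) :
    (fun x => covarianceMap (G.glue (η x)) u v) ∈ B := by
  classical
  have hr' : ∀ j, Function.Injective (fun u : G.componentVertices j => r u) :=
    fun j => hr.comp Subtype.val_injective
  choose R d hRd hR hdB using fun j => exists_isLDL_mem (hr' j) hB
    (fun x => posDef_covarianceMap (hη x j)) (h j)
  refine apply_mem_of_isLDL hr hB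
    (fun x => isLDL_glueCols hr hd (fun j => ((mem_realParams_iff (hr' j)
      fun u v (h : (G.mixedComponent j).directed u v) => hd u v h.1).1 (hη x j)).1)
      fun j => hRd j x) (fun u v => ?_) (fun v => hdB _ _) u v
  simp only [glueCols, extendZero]
  split_ifs
  · exact hR _ _ _
  · exact const_mem B 0

/-- From Σ compute the Σ_j, apply the rational inverses for the G_j and glue the results. -/
theorem rationallyIdentifiable_of_mixedComponents (hr : r.Injective)
    (hd : ∀ u v, G.directed u v → r u < r v)
    (h : ∀ j, (G.mixedComponent j).RationallyIdentifiable) : G.RationallyIdentifiable := by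
  classical
  have hr' : ∀ j, Function.Injective (fun u : G.componentVertices j => r u) :=
    fun j => hr.comp Subtype.val_injective
  have H := fiberSplitting_realParams hr hd
  have hsym : ∀ θ ∈ G.realParams, θ ∈ G.symParams ℝ := fun θ hθ =>
    ((mem_realParams_iff hr hd).1 hθ).1
  choose f hf hT hfrac using fun j => rationallyIdentifiable_iff.1 (h j)
  choose η₀ hη₀ hfη₀ using hT
  -- The parent variances are no parameters of G and may be fixed; taking those of η₀ keeps the
  -- pulled back f j nonzero at the gluing of η₀.
  obtain ⟨w, hw₀⟩ : ∃ w : ∀ j, G.componentVertices j → ℝ, ∀ j u, (η₀ j).2 u u = w j u :=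
    ⟨_, fun _ _ => rfl⟩
  have hw : ∀ j u, 0 < w j u := fun j u => hw₀ j u ▸ (hη₀ j).2.1.diag_pos
  refine rationallyIdentifiable_iff.2
    ⟨fun θ => ∏ j, f j (G.restrictParams j (w j) θ), prod_fun_mem _ fun j _ => ?_,
      ⟨G.glue η₀, H.glue_mem η₀ hη₀, Finset.prod_ne_zero_iff.2 fun j _ => ?_⟩, ?_⟩
  · refine comp_mem_of_mem_polyAlgebra
        (t := G.restrictParams j (w j))
        (restrictParams_coords_mem (θ := fun θ => θ) (w := fun _ => w j)
        (fun u _ => const_mem _ _) fun c => ?_) (hf j)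
    exact mem_polyAlgebra_self (fun c (θ : ParamPair V ℝ) => θ.coords c) c
  · rw [restrictParams_glue j ((mem_realParams_iff (hr' j)
      fun u v (h : (G.mixedComponent j).directed u v) => hd u v h.1).1 (hη₀ j)).1
      fun u _ => hw₀ j u]
    exact hfη₀ j
  let X := {θ // θ ∈ G.realParams ∧ ∏ j, f j (G.restrictParams j (w j) θ) ≠ 0}
  let B : Subalgebra ℝ (X → ℝ) := fracAlgebra
    (polyAlgebra fun (e : V × V) (θ : X) => covarianceMap θ.1 e.1 e.2)
  have hB : B.InvClosed := invClosed_fracAlgebra _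
  have hcov : ∀ j u v, (fun θ : X => covarianceMap (G.restrictParams j (w j) θ.1) u v) ∈ B :=
    fun j => covarianceMap_restrictParams_mem hr hd hB (fun θ : X => θ.2.1) (fun u v =>
      le_fracAlgebra _ (mem_polyAlgebra_self
        (fun (e : V × V) (θ : X) => covarianceMap θ.1 e.1 e.2) (u, v))) (hw j)
  have hmem : ∀ j (θ : X), G.restrictParams j (w j) θ.1 ∈ (G.mixedComponent j).realParams ∧
      f j (G.restrictParams j (w j) θ.1) ≠ 0 := fun j θ =>
    ⟨restrictParams_mem_realParams hr hd θ.2.1 j fun u _ => hw j u,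
      Finset.prod_ne_zero_iff.1 θ.2.2 j (Finset.mem_univ j)⟩
  have hcoords : ∀ j c, (fun θ : X => (G.restrictParams j (w j) θ.1).coords c) ∈ B := by
    intro j c
    let t : X → {y // y ∈ (G.mixedComponent j).realParams ∧ f j y ≠ 0} := fun θ => ⟨_, hmem j θ⟩
    exact comp_mem_of_mem_fracAlgebra (t := t) hB (fun e => hcov j e.1 e.2) (hfrac j c)
  intro c
  have := glue_coords_mem (B := B) hcoords c
  simpa only [fun θ : X => glue_restrictParams (hsym _ θ.2.1) w] using this

/-- Freeze the other components at a generic point. Then Σ is rational in Σ_j, the inverse for G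
recovers the glued parameters, and those of G_j are read off from them. -/
theorem rationallyIdentifiable_mixedComponent (hr : r.Injective)
    (hd : ∀ u v, G.directed u v → r u < r v) (h : G.RationallyIdentifiable)
    (j : G.ComponentIndex) : (G.mixedComponent j).RationallyIdentifiable := by
  classical
  have hr' : ∀ j, Function.Injective (fun u : G.componentVertices j => r u) :=
    fun j => hr.comp Subtype.val_injective
  have H := fiberSplitting_realParams hr hd
  have hsym : ∀ i, ∀ y ∈ (G.mixedComponent i).realParams, y ∈ (G.mixedComponent i).symParams ℝ :=
    fun i y hy => ((mem_realParams_iff (hr' i)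
      fun u v (h : (G.mixedComponent i).directed u v) => hd u v h.1).1 hy).1
  obtain ⟨f, hf, hT, hfrac⟩ := rationallyIdentifiable_iff.1 h
  obtain ⟨η, hη, hfη⟩ := H.exists_glue_ne _ H.exists_ne hf hT
  refine rationallyIdentifiable_iff.2 ⟨fun y => f (G.glue (Function.update η j y)),
    H.comp_update f hf η j, ⟨η j, (hη j).1, by simpa only [Function.update_eq_self] using hfη⟩, ?_⟩
  let X := {y // y ∈ (G.mixedComponent j).realParams ∧ f (G.glue (Function.update η j y)) ≠ 0}
  let B : Subalgebra ℝ (X → ℝ) := fracAlgebra (polyAlgebra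
    fun (e : G.componentVertices j × G.componentVertices j) (y : X) =>
      covarianceMap y.1 e.1 e.2)
  have hB : B.InvClosed := invClosed_fracAlgebra _
  have hcovB : ∀ u v, (fun y : X => covarianceMap y.1 u v) ∈ B := fun u v => le_fracAlgebra _
    (mem_polyAlgebra_self (fun (e : G.componentVertices j × G.componentVertices j) (y : X) =>
      covarianceMap y.1 e.1 e.2) (u, v))
  have hmem : ∀ (y : X) i, Function.update η j y.1 i ∈ (G.mixedComponent i).realParams :=
    fun y => FiberSplitting.update_mem (T' := fun i => (G.mixedComponent i).realParams)
      (fun i => (hη i).1) y.2.1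
  have hS : ∀ i u v, (fun y : X => covarianceMap (Function.update η j y.1 i) u v) ∈ B := by
    intro i u v
    by_cases hij : i = j
    · subst hij; simpa only [Function.update_self] using hcovB u v
    · simp only [Function.update_of_ne hij]; exact const_mem B _
  have hcov : ∀ u v, (fun y : X => covarianceMap (G.glue (Function.update η j y.1)) u v) ∈ B :=
    covarianceMap_glue_mem hr hd hB hmem hS
  have hcoords : ∀ c, (fun y : X => (G.glue (Function.update η j y.1)).coords c) ∈ B :=
    fun c => comp_mem_of_mem_fracAlgebra hB
      (t := fun y : X => ⟨G.glue (Function.update η j y.1), H.glue_mem _ (hmem y), y.2.2⟩)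
      (fun e => hcov e.1 e.2) (hfrac c)
  intro c
  -- The parent variances lost in gluing are diagonal entries of Σ_j, hence available as functions
  -- of it.
  have := restrictParams_coords_mem (j := j) (w := fun y : X => fun u => covarianceMap y.1 u u)
    (fun u _ => hcovB u u) hcoords c
  have he : ∀ y : X, G.restrictParams j (fun u => covarianceMap y.1 u u)
      (G.glue (Function.update η j y.1)) = y.1 := fun y => by
    have h1 := hsym j _ y.2.1
    refine (restrictParams_glue j (by simpa using h1) fun u hu => ?_).trans (by simp)
    rw [Function.update_self]
    exact (covarianceMap_apply_self_of_source y.2.1.1.2 fun v => h1.1 v u fun hh => hu hh.2).symm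
  simpa only [he] using this

end Main

end MixedGraph

theorem theorem9 {V : Type*} [Fintype V] [DecidableEq V] (G : MixedGraph V) (hG : G.Acyclic) :
    -- (i) rational identifiability and generic identifiability
    (G.RationallyIdentifiable ↔ ∀ j, (G.mixedComponent j).RationallyIdentifiable) ∧
    (G.GenericallyIdentifiable ↔ ∀ j, (G.mixedComponent j).GenericallyIdentifiable) ∧
    -- (ii) for the real map and for its complex extension
    (G.GenericallyInfiniteToOne ↔ ∃ j, (G.mixedComponent j).GenericallyInfiniteToOne) ∧
    (IsGenericallyToOne G.complexParams ⊤ ↔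
      ∃ j, IsGenericallyToOne (G.mixedComponent j).complexParams ⊤) ∧
    -- (iii) for the real map and for its complex extension
    (∀ h : G.ComponentIndex → ℕ,
      (∀ j, IsGenericallyToOne (G.mixedComponent j).realParams (h j : ℕ∞)) →
        IsGenericallyToOne G.realParams ((∏ j, h j : ℕ) : ℕ∞)) ∧
    (∀ h : G.ComponentIndex → ℕ,
      (∀ j, IsGenericallyToOne (G.mixedComponent j).complexParams (h j : ℕ∞)) →
        IsGenericallyToOne G.complexParams ((∏ j, h j : ℕ) : ℕ∞)) ∧
    G.identifiabilityDegree = ∏ j, (G.mixedComponent j).identifiabilityDegree := by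
  classical
  obtain ⟨r, hr, hd⟩ := hG.exists_rank
  have HR := MixedGraph.fiberSplitting_realParams hr hd
  have HC := MixedGraph.fiberSplitting_complexParams hr hd
  refine ⟨⟨MixedGraph.rationallyIdentifiable_mixedComponent hr hd,
    MixedGraph.rationallyIdentifiable_of_mixedComponents hr hd⟩, ?_, ?_, ?_, fun h hh => ?_,
    fun h hh => ?_, MixedGraph.prod_identifiabilityDegree hr hd⟩
  · simp only [MixedGraph.genericallyIdentifiable_iff]
    exact HR.separates_iff
  · simp only [MixedGraph.genericallyInfiniteToOne_iff]
    exact HR.infinite_iff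
  · simp only [isGenericallyToOne_iff]
    exact HC.infinite_iff
  · rw [isGenericallyToOne_iff, Nat.cast_prod]
    exact HR.prod_of_generically fun j => isGenericallyToOne_iff.1 (hh j)
  · rw [isGenericallyToOne_iff, Nat.cast_prod]
    exact HC.prod_of_generically fun j => isGenericallyToOne_iff.1 (hh j)
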